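/- Let $X\subset\mathbb R^2$ be the closed unit disk and $0<\varepsilon<1$. For each level $n$ let $C_n$ be the circle about the origin of radius $r_n\in(0,1)$, where $r_n\nearrow1$, covered by finitely many closed disks $D_n(i)$, $i\in K_n$, of common radius $r_n'>0$, none of which meets a circle $C_k$ with $k\ne n$. For $\beta>0$ let $\beta D_n(i)$ be the closed disk with the same centre as $D_n(i)$ and radius $\beta r_n'$. Suppose that all disks $(1+\varepsilon)D_n(i)$ are contained in $X$, that two of them with different $n$ are disjoint, that each $(1+\varepsilon)D_n(i)$ meets at most two others, and that no three distinct ones have a common point. Let $\Lambda=[1-\varepsilon,1+\varepsilon]$, let $\theta:\Lambda\to\Lambda$ be a homeomorphism preserving an absolutely continuous probability measure $m$ on $\Lambda$, and let $h(m)$ be the Kolmogorov--Sinai entropy of $(\theta,m)$. Let $E=\{(n,i): i\in K_n\}$, let $(\nu_e)_{e\in E}$ be a probability vector with $-\sum_{e}\nu_e\log\nu_e<\infty$, let $\nu$ be the corresponding Bernoulli measure on $E^\infty$, and put $\mu=m\times\nu$ (so that the conditional measures are $\mu_\lambda=\nu$). For $e=(n,i)\in E$ and $\lambda\in\Lambda$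 let $\varphi_e^\lambda:X\to X$ be a similarity with ratio $\lambda r_n'$ and image $\varphi_e^\lambda(X)=\lambda D_n(i)$, such that $\lambda\mapsto\varphi_e^\lambda(x)$ is measurable for all $e\in E$ and $x\in X$. Let $\pi_\lambda(\omega)$ be the unique point of $$\bigcap_{n\ge1}\varphi^{\lambda}_{\omega_1}\circ\varphi^{\theta(\lambda)}_{\omega_2}\circ\cdots\circ\varphi^{\theta^{n-1}(\lambda)}_{\omega_n}(X).$$ Then for $\mu$-almost every $(\lambda,\omega)\in\Lambda\times E^\infty$ the pointwise dimension $$d=d_{\mu_\lambda\circ\pi_\lambda^{-1}}(\pi_\lambda(\omega))=\lim_{r\to0}\frac{\log\,(\mu_\lambda\circ\pi_\lambda^{-1})(B(\pi_\lambda(\omega),r))}{\log r}$$ exists (and is finite), $\chi(\lambda)>0$, and $$\frac{h(m)-\sum_{e}\nu_e\log\nu_e-\log2}{\chi(\lambda)}\ \le\ d\ \le\ \frac{h(m)-\sum_{e}\nu_e\log\nu_e}{\chi(\lambda)},$$ where $$\chi(\lambda)=-\tfrac12\big(\log\lambda+\log\theta(\lambda)\big)-\sum_{e=(n,i)\in E}\nu_e\log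 r_n'\ \in(0,\infty],$$ and a quotient with denominator $\infty$ is $0$. If moreover $\theta$ is orientation preserving (in particular if $\theta=\mathrm{id}$), then for $\mu$-almost every $(\lambda,\omega)$ the same assertion holds with $$\chi(\lambda)=-\log\lambda-\sum_{e=(n,i)\in E}\nu_e\log r_n'.$$ -/

import Mathlib

open MeasureTheory Filter Topology

noncomputable section

namespace RandomDiskIFS

/-! ### Measure-theoretic notions -/

/-- The Shannon entropy of the finite partition of `α` into the fibres of `f`. -/
def partitionEntropy {α ι : Type*} [MeasurableSpace α] [Fintype ι] (m : Measure α)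
    (f : α → ι) : ℝ :=
  ∑ i, Real.negMulLog (m.real (f ⁻¹' {i}))

/-- The Kolmogorov-Sinai entropy of the measure-preserving transformation `T` of `(α, m)`:
the supremum, over all finite measurable partitions `f : α → Fin k`, of the growth rate of the
entropy of the join of `f, f ∘ T, …, f ∘ T^(n-1)`. -/
def measureEntropy {α : Type*} [MeasurableSpace α] (m : Measure α) (T : α → α) : EReal :=
  ⨆ (k : ℕ) (f : {f : α → Fin k // Measurable f}),
    limsup (fun n : ℕ =>
      ((partitionEntropy m (fun x => fun j : Fin n => f.1 (T^[j] x)) / n : ℝ) : EReal)) atTop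

/-- `x` is in the support of `μ` and the pointwise dimension
`lim_{r → 0} log μ(B(x, r)) / log r` of `μ` at `x` exists and is equal to `d`.
(Outside the support the quotient would be `+∞`, so no real `d` is a pointwise dimension.) -/
def HasPointwiseDimension {X : Type*} [PseudoMetricSpace X] [MeasurableSpace X]
    (μ : Measure X) (x : X) (d : ℝ) : Prop :=
  (∀ r > 0, 0 < μ (Metric.ball x r)) ∧
    Tendsto (fun r : ℝ => Real.log (μ.real (Metric.ball x r)) / Real.log r) (𝓝[>] 0) (𝓝 d)

/-! ### The geometric setting -/

/-- The Euclidean plane. -/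
abbrev Plane : Type := EuclideanSpace ℝ (Fin 2)

/-- The closed unit disk. -/
abbrev unitDisk : Set Plane := Metric.closedBall 0 1

/-- The parameter interval `[1 - ε, 1 + ε]`. -/
abbrev Param (ε : ℝ) : Type := Set.Icc (1 - ε) (1 + ε)

/-- The countable alphabet of all pairs `(n, i)`, where `i` runs through a finite set with
`N n` elements. -/
abbrev Alphabet (N : ℕ → ℕ) : Type := Σ n : ℕ, Fin (N n)

/-- Circles `C_n` of radius `R n ↗ 1` about the origin, and closed disks `D_n(i)` with centre
`c ⟨n, i⟩` and radius `r n` such that the disks `D_n(i)`, `i < N n`, cover `C_n`. The disks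
`(1 + ε) D_n(i)` lie in the unit disk, those of different levels `n` are disjoint, each of them
meets at most two others of its level, and no three of them have a common point. -/
structure DiskFamily (ε : ℝ) (N : ℕ → ℕ) where
  R : ℕ → ℝ
  R_pos : ∀ n, 0 < R n
  R_lt_one : ∀ n, R n < 1
  R_mono : Monotone R
  R_tendsto : Tendsto R atTop (𝓝 1)
  r : ℕ → ℝ
  r_pos : ∀ n, 0 < r n
  c : Alphabet N → Plane
  covers : ∀ n, Metric.sphere 0 (R n) ⊆ ⋃ i : Fin (N n), Metric.closedBall (c ⟨n, i⟩) (r n)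
  disjoint_circle : ∀ n (i : Fin (N n)) k, k ≠ n →
    Disjoint (Metric.closedBall (c ⟨n, i⟩) (r n)) (Metric.sphere 0 (R k))
  subset_unitDisk : ∀ n (i : Fin (N n)),
    Metric.closedBall (c ⟨n, i⟩) ((1 + ε) * r n) ⊆ unitDisk
  disjoint_level : ∀ n k, n ≠ k → ∀ (i : Fin (N n)) (j : Fin (N k)),
    Disjoint (Metric.closedBall (c ⟨n, i⟩) ((1 + ε) * r n))
      (Metric.closedBall (c ⟨k, j⟩) ((1 + ε) * r k))
  two_neighbours : ∀ n (i : Fin (N n)),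
    {j : Fin (N n) | j ≠ i ∧ (Metric.closedBall (c ⟨n, i⟩) ((1 + ε) * r n) ∩
      Metric.closedBall (c ⟨n, j⟩) ((1 + ε) * r n)).Nonempty}.ncard ≤ 2
  no_triple_point : ∀ n (i j k : Fin (N n)), i ≠ j → i ≠ k → j ≠ k →
    Metric.closedBall (c ⟨n, i⟩) ((1 + ε) * r n) ∩
      Metric.closedBall (c ⟨n, j⟩) ((1 + ε) * r n) ∩
      Metric.closedBall (c ⟨n, k⟩) ((1 + ε) * r n) = ∅

/-- The random maps `φ_e^λ : X → X` of the unit disk `X`: for `e = (n, i)`, a similarity with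
ratio `λ r_n` and image `λ D_n(i)` (same centre as `D_n(i)`, radius `λ r_n`), depending
measurably on `λ`. The values of `toFun e l` outside the unit disk play no role. -/
structure SimilaritySystem {ε : ℝ} {N : ℕ → ℕ} (D : DiskFamily ε N) where
  toFun : Alphabet N → Param ε → Plane → Plane
  dist_eq : ∀ e l, ∀ x ∈ unitDisk, ∀ y ∈ unitDisk,
    dist (toFun e l x) (toFun e l y) = (l : ℝ) * D.r e.1 * dist x y
  image_eq : ∀ e l, toFun e l '' unitDisk = Metric.closedBall (D.c e) ((l : ℝ) * D.r e.1)
  measurable_param : ∀ e, ∀ x ∈ unitDisk, Measurable (fun l => toFun e l x)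

namespace SimilaritySystem

variable {ε : ℝ} {N : ℕ → ℕ} {D : DiskFamily ε N}

/-- The random composition
`φ_{ω|n}^λ = φ_{ω_0}^λ ∘ φ_{ω_1}^{θ(λ)} ∘ ⋯ ∘ φ_{ω_{n-1}}^{θ^{n-1}(λ)}`. -/
def comp (S : SimilaritySystem D) (θ : Param ε → Param ε) :
    ℕ → Param ε → (ℕ → Alphabet N) → Plane → Plane
  | 0, _, _ => id
  | n + 1, l, ω => S.toFun (ω 0) l ∘ S.comp θ n (θ l) (fun k => ω (k + 1))

end SimilaritySystem

lemma norm_add_le_of_closedBall_subset {x : Plane} {a : ℝ} (ha : 0 ≤ a)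
    (h : Metric.closedBall x a ⊆ unitDisk) : ‖x‖ + a ≤ 1 := by
  rcases eq_or_ne x 0 with rfl | hx
  · have hv : (EuclideanSpace.single 0 a : Plane) ∈ Metric.closedBall (0 : Plane) a := by
      simp [abs_of_nonneg ha]
    have := h hv
    simp [abs_of_nonneg ha] at this
    simpa using this
  · have hn : 0 < ‖x‖ := norm_pos_iff.mpr hx
    have hv : x + (a / ‖x‖) • x ∈ Metric.closedBall x a := by
      simp [norm_smul, abs_of_nonneg ha, hn.ne']
    have h1 := h hv
    have h2 : x + (a / ‖x‖) • x = (1 + a / ‖x‖) • x := by rw [add_smul, one_smul]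
    rw [h2, mem_closedBall_zero_iff, norm_smul, Real.norm_of_nonneg (by positivity), add_mul,
      div_mul_cancel₀ _ hn.ne', one_mul] at h1
    exact h1

lemma DiskFamily.nonempty_level {ε : ℝ} {N : ℕ → ℕ} (D : DiskFamily ε N) (n : ℕ) :
    Nonempty (Fin (N n)) := by
  have hv : (EuclideanSpace.single 0 (D.R n) : Plane) ∈ Metric.sphere (0 : Plane) (D.R n) := by
    simp [abs_of_pos (D.R_pos n)]
  obtain ⟨i, -⟩ := Set.mem_iUnion.mp (D.covers n hv)
  exact ⟨i⟩

lemma DiskFamily.radius_add_lt {ε : ℝ} {N : ℕ → ℕ} (hε : 0 < ε) (D : DiskFamily ε N)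
    {n k : ℕ} (h : n ≠ k) : (1 + ε) * D.r n + (1 + ε) * D.r k < 1 := by
  obtain ⟨i⟩ := D.nonempty_level n
  obtain ⟨j⟩ := D.nonempty_level k
  have hn : 0 ≤ (1 + ε) * D.r n := mul_nonneg (by linarith) (D.r_pos n).le
  have hk : 0 ≤ (1 + ε) * D.r k := mul_nonneg (by linarith) (D.r_pos k).le
  have h1 := norm_add_le_of_closedBall_subset hn (D.subset_unitDisk n i)
  have h2 := norm_add_le_of_closedBall_subset hk (D.subset_unitDisk k j)
  have h3 : (1 + ε) * D.r n + (1 + ε) * D.r k < dist (D.c ⟨n, i⟩) (D.c ⟨k, j⟩) := by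
    by_contra hc
    exact hc ((disjoint_closedBall_closedBall_iff hn hk).mp (D.disjoint_level n k h i j))
  have h4 := dist_le_norm_add_norm (D.c ⟨n, i⟩) (D.c ⟨k, j⟩)
  linarith

/-- The contraction ratios are bounded by a common constant smaller than one. -/
lemma DiskFamily.exists_ratio {ε : ℝ} {N : ℕ → ℕ} (hε : 0 < ε) (D : DiskFamily ε N) :
    ∃ s : ℝ, 0 ≤ s ∧ s < 1 ∧ ∀ n, (1 + ε) * D.r n ≤ s := by
  have hp : ∀ n, 0 < (1 + ε) * D.r n := fun n => mul_pos (by linarith) (D.r_pos n)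
  have h01 := D.radius_add_lt hε (n := 0) (k := 1) (by decide)
  refine ⟨max ((1 + ε) * D.r 0) (1 - (1 + ε) * D.r 0), le_max_of_le_left (hp 0).le, ?_, ?_⟩
  · have := hp 0
    have := hp 1
    exact max_lt (by linarith) (by linarith)
  · intro n
    rcases eq_or_ne n 0 with rfl | hn
    · exact le_max_left _ _
    · have := D.radius_add_lt hε hn
      exact le_max_of_le_right (by linarith)

namespace SimilaritySystem

variable {ε : ℝ} {N : ℕ → ℕ} {D : DiskFamily ε N}

lemma mapsTo (S : SimilaritySystem D) (e : Alphabet N) (l : Param ε) :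
    Set.MapsTo (S.toFun e l) unitDisk unitDisk := by
  intro x hx
  have h : S.toFun e l x ∈ S.toFun e l '' unitDisk := ⟨x, hx, rfl⟩
  rw [S.image_eq] at h
  exact D.subset_unitDisk e.1 e.2 (Metric.closedBall_subset_closedBall
    (mul_le_mul_of_nonneg_right l.2.2 (D.r_pos _).le) h)

lemma comp_mapsTo (S : SimilaritySystem D) (θ : Param ε → Param ε) (n : ℕ) :
    ∀ (l : Param ε) (ω : ℕ → Alphabet N),
      Set.MapsTo (S.comp θ n l ω) unitDisk unitDisk := by
  induction n with
  | zero => intro l ω; exact Set.mapsTo_id _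
  | succ n ih => intro l ω; exact (S.mapsTo _ _).comp (ih _ _)

lemma comp_dist_le (S : SimilaritySystem D)
    (θ : Param ε → Param ε) {s : ℝ} (hs0 : 0 ≤ s) (hs : ∀ n, (1 + ε) * D.r n ≤ s) (n : ℕ) :
    ∀ (l : Param ε) (ω : ℕ → Alphabet N), ∀ x ∈ unitDisk, ∀ y ∈ unitDisk,
      dist (S.comp θ n l ω x) (S.comp θ n l ω y) ≤ s ^ n * dist x y := by
  induction n with
  | zero => intro l ω x _ y _; simp [comp]
  | succ n ih =>
    intro l ω x hx y hy
    have h1 := ih (θ l) (fun k => ω (k + 1)) x hx y hy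
    have h2 := S.dist_eq (ω 0) l _ (S.comp_mapsTo θ n (θ l) (fun k => ω (k + 1)) hx) _
      (S.comp_mapsTo θ n (θ l) (fun k => ω (k + 1)) hy)
    have h3 : (l : ℝ) * D.r (ω 0).1 ≤ s :=
      (mul_le_mul_of_nonneg_right l.2.2 (D.r_pos _).le).trans (hs _)
    simp only [comp, Function.comp_apply]
    rw [h2, pow_succ', mul_assoc s]
    exact mul_le_mul h3 h1 dist_nonneg hs0

lemma comp_image_succ_subset (S : SimilaritySystem D) (θ : Param ε → Param ε)
    (n : ℕ) : ∀ (l : Param ε) (ω : ℕ → Alphabet N),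
      S.comp θ (n + 1) l ω '' unitDisk ⊆ S.comp θ n l ω '' unitDisk := by
  induction n with
  | zero =>
    intro l ω
    simpa [comp] using (S.mapsTo (ω 0) l).image_subset
  | succ n ih =>
    intro l ω
    have h : ∀ k, S.comp θ (k + 1) l ω '' unitDisk =
        S.toFun (ω 0) l '' (S.comp θ k (θ l) (fun k => ω (k + 1)) '' unitDisk) := by
      intro k; simp [comp, Set.image_comp]
    rw [h (n + 1), h n]
    exact Set.image_mono (ih _ _)

/-- The sets `φ_{ω|n}^λ(X)` shrink to a single point. -/
lemma existsUnique_codingPoint (hε : 0 < ε) (S : SimilaritySystem D)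
    (θ : Param ε → Param ε) (l : Param ε) (ω : ℕ → Alphabet N) :
    ∃! x : Plane, x ∈ ⋂ n : ℕ, S.comp θ n l ω '' unitDisk := by
  obtain ⟨s, hs0, hs1, hs⟩ := D.exists_ratio hε
  have hcont : ∀ n, ContinuousOn (S.comp θ n l ω) unitDisk := by
    intro n
    have : LipschitzOnWith (Real.toNNReal (s ^ n)) (S.comp θ n l ω) unitDisk :=
      LipschitzOnWith.of_dist_le_mul fun x hx y hy => by
        rw [Real.coe_toNNReal _ (by positivity)]
        exact S.comp_dist_le θ hs0 hs n l ω x hx y hy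
    exact this.continuousOn
  have hcomp : ∀ n, IsCompact (S.comp θ n l ω '' unitDisk) := fun n =>
    (isCompact_closedBall _ _).image_of_continuousOn (hcont n)
  have hne : ∀ n, (S.comp θ n l ω '' unitDisk).Nonempty := fun n =>
    ⟨_, 0, by simp, rfl⟩
  obtain ⟨x, hx⟩ := IsCompact.nonempty_iInter_of_sequence_nonempty_isCompact_isClosed
    (fun n => S.comp θ n l ω '' unitDisk) (fun n => S.comp_image_succ_subset θ n l ω) hne
    (hcomp 0) (fun n => (hcomp n).isClosed)
  refine ⟨x, hx, fun y hy => ?_⟩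
  have hd : ∀ n : ℕ, dist y x ≤ s ^ n * 2 := by
    intro n
    obtain ⟨u, hu, rfl⟩ := Set.mem_iInter.mp hx n
    obtain ⟨v, hv, hvy⟩ := Set.mem_iInter.mp hy n
    rw [← hvy]
    refine (S.comp_dist_le θ hs0 hs n l ω v hv u hu).trans ?_
    refine mul_le_mul_of_nonneg_left ?_ (by positivity)
    have h1 := dist_le_norm_add_norm v u
    have h2 := mem_closedBall_zero_iff.mp hv
    have h3 := mem_closedBall_zero_iff.mp hu
    linarith
  have hlim : Tendsto (fun n : ℕ => s ^ n * 2) atTop (𝓝 0) := by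
    simpa using (tendsto_pow_atTop_nhds_zero_of_lt_one hs0 hs1).mul_const 2
  exact dist_le_zero.mp (ge_of_tendsto' hlim hd)

/-- The coding map `π_λ : E^∞ → J_λ`; `π_λ(ω)` is the point of `⋂ n, φ_{ω|n}^λ(X)`. -/
def coding (S : SimilaritySystem D) (hε : 0 < ε) (θ : Param ε → Param ε)
    (l : Param ε) (ω : ℕ → Alphabet N) : Plane :=
  (S.existsUnique_codingPoint hε θ l ω).choose

lemma iInter_eq_coding (S : SimilaritySystem D) (hε : 0 < ε)
    (θ : Param ε → Param ε) (l : Param ε) (ω : ℕ → Alphabet N) :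
    ⋂ n : ℕ, S.comp θ n l ω '' unitDisk = {S.coding hε θ l ω} := by
  have h := (S.existsUnique_codingPoint hε θ l ω).choose_spec
  exact Set.eq_singleton_iff_unique_mem.mpr ⟨h.1, h.2⟩

end SimilaritySystem

/-! ### The Bernoulli measure, its entropy and the Lyapunov exponent -/

/-- The Bernoulli measure on `E^∞` with weights `ν_e = P e`. -/
def bernoulliMeasure {N : ℕ → ℕ} (P : PMF (Alphabet N)) : Measure (ℕ → Alphabet N) :=
  Measure.infinitePi (fun _ : ℕ => P.toMeasure)

/-- The entropy `-∑ ν_e log ν_e`. It is only used when the series converges. -/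
def weightEntropy {N : ℕ → ℕ} (P : PMF (Alphabet N)) : ℝ :=
  ∑' e, Real.negMulLog (P e).toReal

/-- `-a - ∑ ν_e log r_n`, with `e = (n, i)`. The terms `-log r_n` are positive because
`r_n < 1`, so the series has a value in `[0, ∞]`. -/
def exponent {ε : ℝ} {N : ℕ → ℕ} (D : DiskFamily ε N) (P : PMF (Alphabet N)) (a : ℝ) : EReal :=
  ((-a : ℝ) : EReal) +
    ((∑' e : Alphabet N, P e * ENNReal.ofReal (-Real.log (D.r e.1)) : ENNReal) : EReal)

end RandomDiskIFS

end

/-! A homeomorphism of an interval is strictly monotone or strictly antitone, so `θ ∘ θ` is strictly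
increasing, and a strictly increasing map that preserves a finite measure moves almost no point.
Hence `θ (θ l) = l` for almost every `l`. This gives `h(m) = 0` (`measureEntropy_eq_zero`), and
along the orbit of such an `l` the parameters alternate between `l` and `θ l`. Grouping letters in
pairs therefore turns the coding at `l` into a deterministic self-similar coding over the Bernoulli
measure with the shift by two (`pairCoding`). The pair entropy is twice `weightEntropy P`, the pair
exponent is twice `χ`, and at most four pair images share a point, so `log 4 = 2 log 2` and all
factors two cancel.

For a self-similar measure with overlaps, consider the balls about the code of `ω` whose radii are
twice the products of the first `n` ratios. Similarity and independence express the part of the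
`n`-th ball due to the first letter as the probability of that letter times the mass of the ball of
index `n - 1` at the shifted point. Iteration (`neg_log_meas_ball`) writes minus the logarithm of
the mass as a Birkhoff sum of `-log prob` minus `∑ k < n, info (n - k) ∘ shift^k`. The terms `info
n` converge almost everywhere by Besicovitch differentiation (`ae_tendsto_info`) and have an
integrable supremum by a maximal inequality and finite entropy (`lintegral_iSup_info_lt_top`), so
Maker's theorem applies. The decay rate is the entropy minus the integral of the limit of `info`,
which lies between `0` and `log K` when at most `K` letters can code a point
(`exists_tendsto_neg_log_meas_ball`). Division by the exponent gives the dimension at fixed `l`.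
Fubini transfers the result to the product measure, once the event is shown to be measurable by
means of dyadic radii. -/

/-! ### Pointwise ergodic theorems of Birkhoff and Maker -/

section ErgodicTheorems

variable {Ω : Type*} {T : Ω → Ω}

/-- The running maximum `max_{1 ≤ k ≤ n + 1} (f + f ∘ T + ⋯ + f ∘ T^(k-1))`. -/
def maxBirkhoffSum {Ω : Type*} (T : Ω → Ω) (f : Ω → ℝ) : ℕ → Ω → ℝ
  | 0 => f
  | n + 1 => fun x => f x + max 0 (maxBirkhoffSum T f n (T x))

lemma birkhoffSum_le_maxBirkhoffSum (f : Ω → ℝ) (n : ℕ) :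
    ∀ x, birkhoffSum T f (n + 1) x ≤ maxBirkhoffSum T f n x := by
  induction n with
  | zero => intro x; simp [maxBirkhoffSum]
  | succ n ih =>
    intro x
    rw [birkhoffSum_succ']
    simp only [maxBirkhoffSum]
    have := ih (T x)
    have := le_max_right 0 (maxBirkhoffSum T f n (T x))
    linarith

lemma maxBirkhoffSum_le_succ (f : Ω → ℝ) (n : ℕ) :
    ∀ x, maxBirkhoffSum T f n x ≤ maxBirkhoffSum T f (n + 1) x := by
  induction n with
  | zero => intro x; simp [maxBirkhoffSum]
  | succ n ih =>
    intro x
    have := max_le_max_left 0 (ih (T x))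
    simp only [maxBirkhoffSum] at this ⊢
    linarith

lemma monotone_maxBirkhoffSum (f : Ω → ℝ) (x : Ω) :
    Monotone fun n => maxBirkhoffSum T f n x :=
  monotone_nat_of_le_succ fun n => maxBirkhoffSum_le_succ f n x

/-- The recursion makes the set of bounded running maxima exactly `T`-invariant, so that ergodicity
applies to it. -/
lemma bddAbove_maxBirkhoffSum_comp_iff (f : Ω → ℝ) (x : Ω) :
    BddAbove (Set.range fun n => maxBirkhoffSum T f n (T x)) ↔
      BddAbove (Set.range fun n => maxBirkhoffSum T f n x) := by
  constructor
  · rintro ⟨b, hb⟩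
    refine ⟨f x + max 0 b, ?_⟩
    rintro _ ⟨n, rfl⟩
    refine (maxBirkhoffSum_le_succ f n x).trans ?_
    have := max_le_max_left 0 (hb ⟨n, rfl⟩)
    simp only [maxBirkhoffSum]
    simpa using this
  · rintro ⟨b, hb⟩
    refine ⟨b - f x, ?_⟩
    rintro _ ⟨n, rfl⟩
    have := hb ⟨n + 1, rfl⟩
    simp only [maxBirkhoffSum] at this
    have := le_max_right 0 (maxBirkhoffSum T f n (T x))
    simp only
    linarith

variable [MeasurableSpace Ω] {μ : Measure Ω}

lemma measurable_maxBirkhoffSum (hT : Measurable T) {f : Ω → ℝ} (hf : Measurable f) (n : ℕ) :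
    Measurable (maxBirkhoffSum T f n) := by
  induction n with
  | zero => exact hf
  | succ n ih => exact hf.add (measurable_const.max (ih.comp hT))

lemma integrable_maxBirkhoffSum (hT : MeasurePreserving T μ μ) {f : Ω → ℝ}
    (hf : Integrable f μ) (n : ℕ) : Integrable (maxBirkhoffSum T f n) μ := by
  induction n with
  | zero => exact hf
  | succ n ih =>
    have h1 := (hT.integrable_comp_of_integrable ih).pos_part
    have h2 : Integrable (fun x => f x + max (maxBirkhoffSum T f n (T x)) 0) μ := hf.add h1
    exact h2.congr (ae_of_all _ fun x => by simp only [maxBirkhoffSum, max_comm])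

/-- Write `M n` for the running maximum. If it were unbounded almost everywhere, then `M (n + 1) - M
n ∘ T` would equal `f` as soon as `M n ∘ T ≥ 0`, so its integrals would tend to `∫ f < 0`. The bound
`M n ∘ T ≥ f ∘ T` supplies the domination. By invariance of `μ` these integrals equal `∫ (M (n + 1)
- M n) ≥ 0`, a contradiction. -/
lemma ae_bddAbove_maxBirkhoffSum [IsProbabilityMeasure μ] (hT : Ergodic T μ) {f : Ω → ℝ}
    (hfm : Measurable f) (hf : Integrable f μ) (hneg : ∫ x, f x ∂μ < 0) :
    ∀ᵐ x ∂μ, BddAbove (Set.range fun n => maxBirkhoffSum T f n x) := by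
  have hmeas : MeasurableSet {x | BddAbove (Set.range fun n => maxBirkhoffSum T f n x)} :=
    measurableSet_bddAbove_range fun n => measurable_maxBirkhoffSum hT.measurable hfm n
  have hinv : T ⁻¹' {x | BddAbove (Set.range fun n => maxBirkhoffSum T f n x)} =
      {x | BddAbove (Set.range fun n => maxBirkhoffSum T f n x)} := by
    ext x
    exact bddAbove_maxBirkhoffSum_comp_iff f x
  rcases hT.ae_mem_or_ae_notMem hmeas hinv with h | h
  · exact h
  exfalso
  have hInt := fun n => integrable_maxBirkhoffSum hT.toMeasurePreserving hf n
  have hIntT : ∀ n, Integrable (fun x => maxBirkhoffSum T f n (T x)) μ := fun n =>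
    hT.toMeasurePreserving.integrable_comp_of_integrable (hInt n)
  have hlim : Tendsto (fun n => ∫ x, (maxBirkhoffSum T f (n + 1) x - maxBirkhoffSum T f n (T x)) ∂μ)
      atTop (𝓝 (∫ x, f x ∂μ)) := by
    refine tendsto_integral_of_dominated_convergence (fun x => |f x| + |f (T x)|)
      (fun n => ((hInt (n + 1)).sub (hIntT n)).aestronglyMeasurable)
      (hf.abs.add (hT.toMeasurePreserving.integrable_comp_of_integrable hf).abs) ?_ ?_
    · intro n
      refine ae_of_all _ fun x => ?_
      have h1 : f (T x) ≤ maxBirkhoffSum T f n (T x) := monotone_maxBirkhoffSum f (T x) n.zero_le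
      simp only [maxBirkhoffSum, Real.norm_eq_abs]
      have := neg_abs_le (f (T x))
      have := neg_abs_le (f x)
      have := le_abs_self (f x)
      have := abs_nonneg (f (T x))
      rcases max_cases 0 (maxBirkhoffSum T f n (T x)) with h | h <;> rw [abs_le] <;>
        constructor <;> linarith
    · filter_upwards [h] with x hx
      have hx' : ¬ BddAbove (Set.range fun n => maxBirkhoffSum T f n (T x)) := by
        rwa [bddAbove_maxBirkhoffSum_comp_iff]
      have ht := tendsto_atTop_atTop_of_monotone' (monotone_maxBirkhoffSum f (T x)) hx'
      refine tendsto_const_nhds.congr' ?_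
      filter_upwards [ht.eventually_ge_atTop 0] with n hn
      simp [maxBirkhoffSum, max_eq_right hn]
  refine hneg.not_ge (ge_of_tendsto' hlim fun n => ?_)
  rw [integral_sub (hInt (n + 1)) (hIntT n)]
  have h2 : ∫ x, maxBirkhoffSum T f n (T x) ∂μ = ∫ x, maxBirkhoffSum T f n x ∂μ := by
    have := integral_map (μ := μ) (φ := T) hT.measurable.aemeasurable
      (f := maxBirkhoffSum T f n) (by rw [hT.map_eq]; exact (hInt n).aestronglyMeasurable)
    rw [hT.map_eq] at this
    exact this.symm
  rw [h2, sub_nonneg]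
  exact integral_mono (hInt n) (hInt (n + 1)) (maxBirkhoffSum_le_succ f n)

/-- For `b` strictly between the mean and `c`, the function `f - b` has negative mean, so its
Birkhoff sums stay below some `B`, and the averages of `f` are at most `b + B / n`. -/
lemma ae_eventually_birkhoffAverage_lt [IsProbabilityMeasure μ] (hT : Ergodic T μ) {f : Ω → ℝ}
    (hfm : Measurable f) (hf : Integrable f μ) {c : ℝ} (hc : ∫ x, f x ∂μ < c) :
    ∀ᵐ x ∂μ, ∀ᶠ n in atTop, birkhoffAverage ℝ T f n x < c := by
  obtain ⟨b, hb1, hb2⟩ := exists_between hc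
  have hneg : ∫ x, (f x - b) ∂μ < 0 := by
    rw [integral_sub hf (integrable_const _)]
    simpa using hb1
  filter_upwards [ae_bddAbove_maxBirkhoffSum hT (hfm.sub_const b)
    (hf.sub (integrable_const b)) hneg] with x hx
  obtain ⟨B, hB⟩ := hx
  have hlim : Tendsto (fun n : ℕ => B / (n : ℝ)) atTop (𝓝 0) :=
    tendsto_const_div_atTop_nhds_zero_nat B
  filter_upwards [hlim.eventually (gt_mem_nhds (sub_pos.mpr hb2)), eventually_gt_atTop 0]
    with n hn hn0
  obtain ⟨k, rfl⟩ := Nat.exists_eq_succ_of_ne_zero hn0.ne'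
  have h1 := (birkhoffSum_le_maxBirkhoffSum (T := T) (fun x => f x - b) k x).trans (hB ⟨k, rfl⟩)
  have h2 : birkhoffSum T (fun x => f x - b) (k + 1) x =
      birkhoffSum T f (k + 1) x - (k + 1 : ℕ) * b := by
    simp [birkhoffSum, Finset.sum_sub_distrib]
  rw [h2] at h1
  have hk : (0 : ℝ) < (k + 1 : ℕ) := by positivity
  rw [Nat.succ_eq_add_one, div_lt_iff₀ hk] at hn
  rw [birkhoffAverage, smul_eq_mul, inv_mul_lt_iff₀ hk]
  linarith

/-- Birkhoff's pointwise ergodic theorem for ergodic transformations. -/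
theorem ae_tendsto_birkhoffAverage [IsProbabilityMeasure μ] (hT : Ergodic T μ) {f : Ω → ℝ}
    (hfm : Measurable f) (hf : Integrable f μ) :
    ∀ᵐ x ∂μ, Tendsto (fun n => birkhoffAverage ℝ T f n x) atTop (𝓝 (∫ x, f x ∂μ)) := by
  have h1 : ∀ k : ℕ, ∀ᵐ x ∂μ, ∀ᶠ n in atTop,
      birkhoffAverage ℝ T f n x < ∫ x, f x ∂μ + 1 / (k + 1 : ℝ) := fun k =>
    ae_eventually_birkhoffAverage_lt hT hfm hf (by
      have : (0 : ℝ) < 1 / (k + 1 : ℝ) := by positivity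
      linarith)
  have h2 : ∀ k : ℕ, ∀ᵐ x ∂μ, ∀ᶠ n in atTop,
      birkhoffAverage ℝ T (-f) n x < -∫ x, f x ∂μ + 1 / (k + 1 : ℝ) := fun k =>
    ae_eventually_birkhoffAverage_lt hT hfm.neg hf.neg (by
      have : (0 : ℝ) < 1 / (k + 1 : ℝ) := by positivity
      simp only [Pi.neg_apply, integral_neg]
      linarith)
  filter_upwards [ae_all_iff.mpr h1, ae_all_iff.mpr h2] with x hx1 hx2
  rw [Metric.tendsto_nhds]
  intro δ hδ
  obtain ⟨k, hk⟩ := exists_nat_one_div_lt hδ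
  filter_upwards [hx1 k, hx2 k] with n hn1 hn2
  rw [birkhoffAverage_neg, Pi.neg_apply, Pi.neg_apply] at hn2
  rw [Real.dist_eq, abs_lt]
  constructor <;> linarith

/-- The averages of a nonnegative function which is not integrable tend to infinity. -/
theorem ae_tendsto_birkhoffAverage_atTop [IsProbabilityMeasure μ] (hT : Ergodic T μ) {f : Ω → ℝ}
    (hfm : Measurable f) (hf0 : ∀ x, 0 ≤ f x) (hf : ∫⁻ x, ENNReal.ofReal (f x) ∂μ = ⊤) :
    ∀ᵐ x ∂μ, Tendsto (fun n => birkhoffAverage ℝ T f n x) atTop atTop := by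
  have hm : ∀ k : ℕ, Measurable fun x => min (f x) k := fun k => hfm.min measurable_const
  have hi : ∀ k : ℕ, Integrable (fun x => min (f x) k) μ := fun k =>
    Integrable.of_bound (hm k).aestronglyMeasurable k (ae_of_all _ fun x => by
      rw [Real.norm_of_nonneg (le_min (hf0 x) k.cast_nonneg)]
      exact min_le_right _ _)
  have hlim : Tendsto (fun k : ℕ => ∫⁻ x, ENNReal.ofReal (min (f x) k) ∂μ) atTop (𝓝 ⊤) := by
    rw [← hf]
    refine lintegral_tendsto_of_tendsto_of_monotone
      (fun k => (hm k).ennreal_ofReal.aemeasurable) (ae_of_all _ fun x => ?_)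
      (ae_of_all _ fun x => ?_)
    · intro k l hkl
      exact ENNReal.ofReal_le_ofReal (min_le_min_left _ (by exact_mod_cast hkl))
    · refine tendsto_const_nhds.congr' ?_
      filter_upwards [tendsto_natCast_atTop_atTop.eventually_ge_atTop (f x)] with k hk
      rw [min_eq_left hk]
  filter_upwards [ae_all_iff.mpr fun k => ae_tendsto_birkhoffAverage hT (hm k) (hi k)] with x hx
  rw [tendsto_atTop]
  intro b
  obtain ⟨k, hk⟩ := (hlim.eventually (lt_mem_nhds (ENNReal.ofReal_lt_top (r := b + 1)))).exists
  rw [← ofReal_integral_eq_lintegral_ofReal (hi k)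
    (ae_of_all _ fun x => le_min (hf0 x) k.cast_nonneg)] at hk
  have hk' := (ENNReal.ofReal_lt_ofReal_iff'.mp hk).1
  filter_upwards [(hx k).eventually (lt_mem_nhds (show b < _ by linarith))] with n hn
  refine hn.le.trans ?_
  rw [birkhoffAverage, birkhoffAverage, smul_eq_mul, smul_eq_mul]
  exact mul_le_mul_of_nonneg_left (Finset.sum_le_sum fun i _ => min_le_left _ _) (by positivity)

/-- Maker's ergodic theorem: if `g n → g∞` almost everywhere, dominated by an integrable function,
then `(1/n) ∑_{k < n} g (n - k) ∘ T^k` tends to the integral of `g∞`. -/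
theorem ae_tendsto_average_of_dominated [IsProbabilityMeasure μ] (hT : Ergodic T μ)
    {g : ℕ → Ω → ℝ} {g' Ψ : Ω → ℝ} (hg : ∀ n, Measurable (g n)) (hg' : Measurable g')
    (hΨm : Measurable Ψ) (hΨ : Integrable Ψ μ) (hb : ∀ᵐ x ∂μ, ∀ n, |g n x| ≤ Ψ x)
    (hlim : ∀ᵐ x ∂μ, Tendsto (fun n => g n x) atTop (𝓝 (g' x))) :
    ∀ᵐ x ∂μ, Tendsto (fun n : ℕ => (∑ k ∈ Finset.range n, g (n - k) (T^[k] x)) / n) atTop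
      (𝓝 (∫ x, g' x ∂μ)) := by
  have hb' : ∀ᵐ x ∂μ, |g' x| ≤ Ψ x := by
    filter_upwards [hb, hlim] with x h1 h2
    exact le_of_tendsto' h2.abs h1
  have hg'i : Integrable g' μ := hΨ.mono' hg'.aestronglyMeasurable hb'
  -- `G j` controls all errors with index at least `j`, and its integral tends to zero. The cap `2 *
  -- Ψ x` is inactive almost everywhere; it keeps the real supremum bounded at every point.
  let G : ℕ → Ω → ℝ := fun j x => ⨆ i, min |g (j + i) x - g' x| (2 * Ψ x)
  have hGm : ∀ j, Measurable (G j) := fun j =>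
    Measurable.iSup fun i => ((hg _).sub hg').abs.min (hΨm.const_mul 2)
  have hle : ∀ᵐ x ∂μ, ∀ n, |g n x - g' x| ≤ 2 * Ψ x := by
    filter_upwards [hb, hb'] with x h1 h2 n
    have := abs_sub (g n x) (g' x)
    have := h1 n
    linarith
  have hGbdd : ∀ j x, BddAbove (Set.range fun i => min |g (j + i) x - g' x| (2 * Ψ x)) := by
    rintro j x
    refine ⟨2 * Ψ x, ?_⟩
    rintro _ ⟨i, rfl⟩
    exact min_le_right _ _
  have hgG : ∀ᵐ x ∂μ, ∀ j n, j ≤ n → |g n x - g' x| ≤ G j x := by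
    filter_upwards [hle] with x hx j n hjn
    obtain ⟨i, rfl⟩ := Nat.exists_eq_add_of_le hjn
    refine le_trans (le_of_eq ?_) (le_ciSup (hGbdd j x) i)
    rw [min_eq_left (hx _)]
  have hG2 : ∀ j x, G j x ≤ 2 * Ψ x := fun j x => ciSup_le fun i => min_le_right _ _
  have hG0 : ∀ᵐ x ∂μ, ∀ j, 0 ≤ G j x := by
    filter_upwards [hgG] with x hx j
    exact (abs_nonneg _).trans (hx j j le_rfl)
  have hGi : ∀ j, Integrable (G j) μ := fun j => by
    refine (hΨ.const_mul 2).mono' (hGm j).aestronglyMeasurable ?_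
    filter_upwards [hG0] with x hx
    rw [Real.norm_of_nonneg (hx j)]
    exact hG2 j x
  have hGlim : Tendsto (fun j => ∫ x, G j x ∂μ) atTop (𝓝 0) := by
    have : Tendsto (fun j => ∫ x, G j x ∂μ) atTop (𝓝 (∫ _, (0 : ℝ) ∂μ)) := by
      refine tendsto_integral_of_dominated_convergence (fun x => 2 * Ψ x)
        (fun j => (hGm j).aestronglyMeasurable) (hΨ.const_mul 2) ?_ ?_
      · intro j
        filter_upwards [hG0] with x hx
        rw [Real.norm_of_nonneg (hx j)]
        exact hG2 j x
      · filter_upwards [hlim, hG0] with x hx hx0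
        rw [Metric.tendsto_atTop]
        intro δ hδ
        obtain ⟨J, hJ⟩ := Metric.tendsto_atTop.mp hx (δ / 2) (half_pos hδ)
        refine ⟨J, fun j hj => ?_⟩
        rw [Real.dist_eq, sub_zero, abs_of_nonneg (hx0 j)]
        refine lt_of_le_of_lt (ciSup_le fun i => (min_le_left _ _).trans ?_) (half_lt_self hδ)
        exact (hJ (j + i) (by omega)).le
    simpa using this
  have hall : ∀ {p : Ω → Prop}, (∀ᵐ x ∂μ, p x) → ∀ᵐ x ∂μ, ∀ k, p (T^[k] x) := fun {p} hp =>
    ae_all_iff.mpr fun k =>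
      (hT.toMeasurePreserving.iterate k).quasiMeasurePreserving.ae hp
  filter_upwards [ae_tendsto_birkhoffAverage hT hg' hg'i,
    ae_all_iff.mpr fun j => ae_tendsto_birkhoffAverage hT (hGm j) (hGi j),
    hall hgG, hall hG0] with x hx hxG hxg hx0
  have hdiff : Tendsto (fun n : ℕ =>
      (∑ k ∈ Finset.range n, |g (n - k) (T^[k] x) - g' (T^[k] x)|) / n) atTop (𝓝 0) := by
    rw [Metric.tendsto_nhds]
    intro δ hδ
    obtain ⟨J, hJ⟩ := (hGlim.eventually (gt_mem_nhds (half_pos hδ))).exists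
    -- the last `J` terms contribute `o(n)`
    have htail : Tendsto (fun n : ℕ => (birkhoffSum T (G 0) n x - birkhoffSum T (G 0) (n - J) x) / n)
        atTop (𝓝 0) := by
      have h1 : Tendsto (fun n : ℕ => birkhoffAverage ℝ T (G 0) (n - J) x) atTop
          (𝓝 (∫ x, G 0 x ∂μ)) := (hxG 0).comp (tendsto_sub_atTop_nat J)
      have h2 : Tendsto (fun n : ℕ => ((n - J : ℕ) : ℝ) / n) atTop (𝓝 1) := by
        have h3 : Tendsto (fun n : ℕ => 1 - (J : ℝ) / n) atTop (𝓝 (1 - 0)) :=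
          tendsto_const_nhds.sub (tendsto_const_div_atTop_nhds_zero_nat _)
        rw [sub_zero] at h3
        refine h3.congr' ?_
        filter_upwards [eventually_ge_atTop J, eventually_gt_atTop 0] with n hn hn0
        have : (n : ℝ) ≠ 0 := by positivity
        rw [Nat.cast_sub hn]
        field_simp
      have h4 := (hxG 0).sub (h1.mul h2)
      rw [mul_one, sub_self] at h4
      refine h4.congr' ?_
      filter_upwards [eventually_gt_atTop J] with n hn
      have hn0 : (n : ℝ) ≠ 0 := by
        have : 0 < n := by omega
        positivity
      have hn1 : ((n - J : ℕ) : ℝ) ≠ 0 := by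
        have : 0 < n - J := by omega
        positivity
      simp only [birkhoffAverage, smul_eq_mul]
      field_simp
    have hsum := (hxG J).add htail
    rw [add_zero] at hsum
    filter_upwards [hsum.eventually (gt_mem_nhds (hJ.trans (half_lt_self hδ))),
      eventually_gt_atTop J] with n hn hnJ
    have hn0 : (0 : ℝ) < n := by
      have : 0 < n := by omega
      positivity
    rw [Real.dist_eq, sub_zero, abs_of_nonneg (by positivity)]
    refine lt_of_le_of_lt ?_ hn
    rw [birkhoffAverage, smul_eq_mul, div_eq_inv_mul, div_eq_inv_mul, ← mul_add]
    refine mul_le_mul_of_nonneg_left ?_ (by positivity)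
    simp only [birkhoffSum]
    -- For `k < n - J` the index `n - k` exceeds `J`, so `G J` bounds the term. The last `J` terms
    -- have small indices and are bounded only by `G 0`.
    have hsplit : ∀ u : ℕ → ℝ, ∑ k ∈ Finset.range n, u k =
        ∑ k ∈ Finset.range (n - J), u k + ∑ k ∈ Finset.Ico (n - J) n, u k := fun u =>
      (Finset.sum_range_add_sum_Ico u (Nat.sub_le n J)).symm
    rw [hsplit fun k => |g (n - k) (T^[k] x) - g' (T^[k] x)|, hsplit fun k => G J (T^[k] x),
      hsplit fun k => G 0 (T^[k] x)]
    have e1 : ∑ k ∈ Finset.range (n - J), |g (n - k) (T^[k] x) - g' (T^[k] x)| ≤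
        ∑ k ∈ Finset.range (n - J), G J (T^[k] x) := by
      refine Finset.sum_le_sum fun k hk => hxg k J _ ?_
      have := Finset.mem_range.mp hk
      omega
    have e2 : ∑ k ∈ Finset.Ico (n - J) n, |g (n - k) (T^[k] x) - g' (T^[k] x)| ≤
        ∑ k ∈ Finset.Ico (n - J) n, G 0 (T^[k] x) :=
      Finset.sum_le_sum fun k _ => hxg k 0 _ (Nat.zero_le _)
    have e3 : 0 ≤ ∑ k ∈ Finset.Ico (n - J) n, G J (T^[k] x) :=
      Finset.sum_nonneg fun k _ => hx0 k J
    linarith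
  have hd : Tendsto (fun n : ℕ =>
      (∑ k ∈ Finset.range n, (g (n - k) (T^[k] x) - g' (T^[k] x))) / n) atTop (𝓝 0) := by
    refine squeeze_zero_norm (fun n => ?_) hdiff
    rw [Real.norm_eq_abs, abs_div, Nat.abs_cast]
    gcongr
    exact Finset.abs_sum_le_sum_abs _ _
  have := hd.add hx
  rw [zero_add] at this
  refine this.congr fun n => ?_
  rw [birkhoffAverage, smul_eq_mul, birkhoffSum, Finset.sum_sub_distrib, sub_div, div_eq_inv_mul,
    div_eq_inv_mul]
  ring

end ErgodicTheorems

/-! ### From a sequence of radii to all radii -/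

section Deterministic

/-- For `R (n + 1) < r ≤ R n` the quotient lies between `log (U n) / log (R (n + 1))` and `log (U (n
+ 1)) / log (R n)`. Both tend to `h * c`, since moving the index by one costs only a factor `(n + 1)
/ n`. Using `n / -log (R n)` instead of its inverse lets `c = 0` cover an infinite exponent. -/
lemma tendsto_log_div_log_of_seq {V : ℝ → ℝ} {U R : ℕ → ℝ} {h c : ℝ} (hU : ∀ n, 0 < U n)
    (hU1 : ∀ n, U n ≤ 1) (hR : ∀ n, 0 < R n) (hR0 : Tendsto R atTop (𝓝 0))
    (hVU : ∀ n r, R (n + 1) < r → r ≤ R n → U (n + 1) ≤ V r ∧ V r ≤ U n)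
    (hlimU : Tendsto (fun n : ℕ => -Real.log (U n) / n) atTop (𝓝 h))
    (hlimR : Tendsto (fun n : ℕ => (n : ℝ) / -Real.log (R n)) atTop (𝓝 c)) :
    Tendsto (fun r => Real.log (V r) / Real.log r) (𝓝[>] 0) (𝓝 (h * c)) := by
  have hn1 : Tendsto (fun n : ℕ => ((n : ℝ) + 1) / n) atTop (𝓝 1) := by
    have h3 : Tendsto (fun n : ℕ => 1 + (1 : ℝ) / n) atTop (𝓝 (1 + 0)) :=
      tendsto_const_nhds.add (tendsto_const_div_atTop_nhds_zero_nat _)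
    rw [add_zero] at h3
    refine h3.congr' ?_
    filter_upwards [eventually_gt_atTop 0] with n hn
    have : (n : ℝ) ≠ 0 := by positivity
    field_simp
  have ha : Tendsto (fun n : ℕ => -Real.log (U (n + 1)) / -Real.log (R n)) atTop (𝓝 (h * c)) := by
    have := ((hlimU.comp (tendsto_add_atTop_nat 1)).mul hn1).mul hlimR
    rw [mul_one] at this
    refine this.congr' ?_
    filter_upwards [eventually_gt_atTop 0] with n hn
    have h1 : (n : ℝ) ≠ 0 := by positivity
    have h2 : (n : ℝ) + 1 ≠ 0 := by positivity
    simp only [Function.comp_apply, Nat.cast_add, Nat.cast_one]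
    rw [div_mul_div_cancel₀ h2, div_mul_div_cancel₀ h1]
  have hb : Tendsto (fun n : ℕ => -Real.log (U n) / -Real.log (R (n + 1))) atTop (𝓝 (h * c)) := by
    have hinv := hn1.inv₀ one_ne_zero
    have := (hlimU.mul hinv).mul (hlimR.comp (tendsto_add_atTop_nat 1))
    rw [inv_one, mul_one] at this
    refine this.congr' ?_
    filter_upwards [eventually_gt_atTop 0] with n hn
    have h1 : (n : ℝ) ≠ 0 := by positivity
    have h2 : (n : ℝ) + 1 ≠ 0 := by positivity
    simp only [Function.comp_apply, Nat.cast_add, Nat.cast_one]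
    rw [inv_div, div_mul_div_cancel₀ h1, div_mul_div_cancel₀ h2]
  rw [Metric.tendsto_nhds]
  intro δ hδ
  obtain ⟨n0, hn0⟩ := eventually_atTop.mp (((Metric.tendsto_nhds.mp ha δ hδ).and
    (Metric.tendsto_nhds.mp hb δ hδ)).and (hR0.eventually (gt_mem_nhds one_pos)))
  -- Since `R` need not be monotone, `r` is taken below all of `R 0, …, R n0`; the first index with
  -- `R n < r` is then a successor and exceeds `n0`.
  have hev : ∀ᶠ r in 𝓝[>] (0 : ℝ), 0 < r ∧ ∀ n ≤ n0, r ≤ R n := by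
    refine (eventually_mem_nhdsWithin).and (nhdsWithin_le_nhds ?_)
    refine ((Set.finite_Iic n0).eventually_all).mpr fun n _ => ?_
    filter_upwards [gt_mem_nhds (hR n)] with r hr using hr.le
  filter_upwards [hev] with r ⟨hr0, hr⟩
  have hex : ∃ n, R n < r := (hR0.eventually (gt_mem_nhds hr0)).exists
  classical
  obtain ⟨n, hn⟩ : ∃ n, Nat.find hex = n + 1 := by
    refine Nat.exists_eq_succ_of_ne_zero fun h0 => ?_
    have := Nat.find_spec hex
    rw [h0] at this
    exact this.not_ge (hr 0 (Nat.zero_le _))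
  have hlt : R (n + 1) < r := hn ▸ Nat.find_spec hex
  have hle : r ≤ R n := not_lt.mp (Nat.find_min hex (by omega))
  have hnn : n0 ≤ n := by
    by_contra hcon
    exact hlt.not_ge (hr (n + 1) (by omega))
  obtain ⟨⟨h1, h2⟩, h3⟩ := hn0 n hnn
  obtain ⟨h4, h5⟩ := hVU n r hlt hle
  have hV : 0 < V r := (hU _).trans_le h4
  have hr1 : r < 1 := hle.trans_lt h3
  have l1 : 0 < -Real.log (R n) := neg_pos.mpr (Real.log_neg (hR n) h3)
  have l2 : -Real.log (R n) ≤ -Real.log r := neg_le_neg (Real.log_le_log hr0 hle)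
  have l3 : -Real.log r ≤ -Real.log (R (n + 1)) := neg_le_neg (Real.log_le_log (hR _) hlt.le)
  have l4 : -Real.log (U n) ≤ -Real.log (V r) := neg_le_neg (Real.log_le_log hV h5)
  have l5 : -Real.log (V r) ≤ -Real.log (U (n + 1)) := neg_le_neg (Real.log_le_log (hU _) h4)
  have l6 : 0 ≤ -Real.log (U n) := neg_nonneg.mpr (Real.log_nonpos (hU n).le (hU1 n))
  rw [← neg_div_neg_eq]
  have u1 : -Real.log (V r) / -Real.log r ≤ -Real.log (U (n + 1)) / -Real.log (R n) :=
    div_le_div₀ (by linarith) l5 l1 l2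
  have u2 : -Real.log (U n) / -Real.log (R (n + 1)) ≤ -Real.log (V r) / -Real.log r :=
    div_le_div₀ (by linarith) l4 (by linarith) l3
  rw [Real.dist_eq, abs_lt] at h1 h2 ⊢
  constructor <;> linarith [h1.1, h1.2, h2.1, h2.2]

end Deterministic

/-! ### A maximal inequality for two measures -/

section Besicovitch

/-- A weak-type maximal inequality for two measures, from the Besicovitch covering theorem. -/
theorem exists_mul_measure_le_of_closedBall (E : Type*) [MetricSpace E]
    [SecondCountableTopology E] [MeasurableSpace E] [OpensMeasurableSpace E]
    [HasBesicovitchCovering E] :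
    ∃ N : ℕ, ∀ (κ μ : Measure E) (t : ENNReal) (A : Set E) (R : ℝ),
      (∀ x ∈ A, ∃ r, 0 < r ∧ r ≤ R ∧
        t * κ (Metric.closedBall x r) ≤ μ (Metric.closedBall x r)) →
      t * κ A ≤ N * μ Set.univ := by
  obtain ⟨N, τ, hτ, hN⟩ := HasBesicovitchCovering.no_satelliteConfig (α := E)
  refine ⟨N, fun κ μ t A R h => ?_⟩
  choose! r hr0 hrR hr using h
  let q : Besicovitch.BallPackage A E :=
    { c := fun x => x
      r := fun x => r x
      rpos := fun x => hr0 x x.2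
      r_bound := R
      r_le := fun x => hrR x x.2 }
  obtain ⟨s, hs, hcov⟩ := Besicovitch.exist_disjoint_covering_families hτ hN q
  have hcount : ∀ i, (s i).Countable := fun i =>
    (hs i).countable_of_nonempty_interior fun j _ =>
      ⟨j, Metric.ball_subset_interior_closedBall (Metric.mem_ball_self (hr0 j j.2))⟩
  have hA : A ⊆ ⋃ i : Fin N, ⋃ j ∈ s i, Metric.closedBall (q.c j) (q.r j) := by
    intro x hx
    have := hcov ⟨⟨x, hx⟩, rfl⟩
    simp only [Set.mem_iUnion] at this ⊢
    obtain ⟨i, j, hj, hxj⟩ := this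
    exact ⟨i, j, hj, Metric.ball_subset_closedBall hxj⟩
  calc t * κ A ≤ t * ∑ i : Fin N, κ (⋃ j ∈ s i, Metric.closedBall (q.c j) (q.r j)) := by
        gcongr
        refine (measure_mono hA).trans ((measure_iUnion_le _).trans ?_)
        rw [tsum_fintype]
    _ = ∑ i : Fin N, t * κ (⋃ j ∈ s i, Metric.closedBall (q.c j) (q.r j)) := Finset.mul_sum _ _ _
    _ ≤ ∑ i : Fin N, μ Set.univ := by
        refine Finset.sum_le_sum fun i _ => ?_
        have hm : ∀ j ∈ s i, MeasurableSet (Metric.closedBall (q.c j) (q.r j)) := fun j _ =>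
          Metric.isClosed_closedBall.measurableSet
        rw [measure_biUnion (hcount i) (hs i) hm, ← ENNReal.tsum_mul_left]
        calc ∑' j : s i, t * κ (Metric.closedBall (q.c j) (q.r j))
            ≤ ∑' j : s i, μ (Metric.closedBall (q.c j) (q.r j)) :=
              ENNReal.tsum_le_tsum fun j => hr _ j.1.2
          _ = μ (⋃ j ∈ s i, Metric.closedBall (q.c j) (q.r j)) :=
              (measure_biUnion (hcount i) (hs i) hm).symm
          _ ≤ μ Set.univ := measure_mono (Set.subset_univ _)
    _ = N * μ Set.univ := by simp

end Besicovitch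

/-! ### Self-similar codings and the recursion for masses of balls -/

/-- A coding of a self-similar measure: points of the ergodic system `(Ω, μ, shift)` have a letter,
independent of the shifted point, and two points with the same letter are coded by the images of
the codes of the shifted points under a similarity. -/
structure SelfSimilarCoding {Ω : Type*} [MeasurableSpace Ω] (μ : Measure Ω) (A E : Type*)
    [MeasurableSpace A] [MetricSpace E] [MeasurableSpace E] where
  shift : Ω → Ω
  ergodic : Ergodic shift μ
  letter : Ω → A
  measurable_letter : Measurable letter
  indep : ∀ a B, MeasurableSet B →
    μ (letter ⁻¹' {a} ∩ shift ⁻¹' B) = μ (letter ⁻¹' {a}) * μ B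
  coding : Ω → E
  measurable_coding : Measurable coding
  dist_coding_le : ∀ ω ω', dist (coding ω) (coding ω') ≤ 2
  ratio : A → ℝ
  ratio_pos : ∀ a, 0 < ratio a
  bound : ℝ
  bound_lt_one : bound < 1
  ratio_le : ∀ a, ratio a ≤ bound
  dist_coding : ∀ ω ω', letter ω = letter ω' →
    dist (coding ω) (coding ω') = ratio (letter ω) * dist (coding (shift ω)) (coding (shift ω'))

noncomputable section

namespace SelfSimilarCoding

variable {Ω A E : Type*} [MeasurableSpace Ω] {μ : Measure Ω} [MeasurableSpace A] [MetricSpace E]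
  [MeasurableSpace E] (C : SelfSimilarCoding μ A E)

/-- The projected measure. -/
def meas : Measure E := μ.map C.coding

/-- The part of the projected measure coming from the letter `a`. -/
def piece (a : A) : Measure E := (μ.restrict (C.letter ⁻¹' {a})).map C.coding

/-- The probability of the letter `a`. -/
def prob (a : A) : ℝ := μ.real (C.letter ⁻¹' {a})

/-- The product of the first `n` ratios along the orbit of `ω`, times two. -/
def radius (C : SelfSimilarCoding μ A E) : ℕ → Ω → ℝ
  | 0, _ => 2
  | n + 1, ω => C.ratio (C.letter ω) * radius C n (C.shift ω)

/-- The ball about the code of `ω` with radius `radius n ω`. -/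
def ball (n : ℕ) (ω : Ω) : Set E := Metric.closedBall (C.coding ω) (C.radius n ω)

/-- The logarithm of the proportion of the projected measure of `ball n ω` due to the letter
of `ω`, with the opposite sign. -/
def info (n : ℕ) (ω : Ω) : ℝ :=
  -Real.log ((C.piece (C.letter ω) (C.ball n ω) / C.meas (C.ball n ω)).toReal)

lemma bound_pos (ω : Ω) : 0 < C.bound := (C.ratio_pos (C.letter ω)).trans_le (C.ratio_le _)

lemma radius_pos (n : ℕ) : ∀ ω, 0 < C.radius n ω := by
  induction n with
  | zero => intro ω; simp [radius]
  | succ n ih => intro ω; exact mul_pos (C.ratio_pos _) (ih _)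

lemma radius_le (n : ℕ) : ∀ ω, C.radius n ω ≤ C.bound ^ n * 2 := by
  induction n with
  | zero => intro ω; simp [radius]
  | succ n ih =>
    intro ω
    rw [pow_succ', mul_assoc]
    exact mul_le_mul (C.ratio_le _) (ih _) (C.radius_pos n _).le (C.bound_pos ω).le

lemma tendsto_radius (ω : Ω) : Tendsto (fun n => C.radius n ω) atTop (𝓝 0) := by
  have : Tendsto (fun n : ℕ => C.bound ^ n * 2) atTop (𝓝 0) := by
    simpa using (tendsto_pow_atTop_nhds_zero_of_lt_one (C.bound_pos ω).le
      C.bound_lt_one).mul_const 2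
  exact squeeze_zero (fun n => (C.radius_pos n ω).le) (fun n => C.radius_le n ω) this

lemma radius_le_two (n : ℕ) (ω : Ω) : C.radius n ω ≤ 2 := by
  refine (C.radius_le n ω).trans ?_
  have := pow_le_one₀ (n := n) (C.bound_pos ω).le C.bound_lt_one.le
  linarith

lemma neg_log_radius (n : ℕ) : ∀ ω, -Real.log (C.radius n ω) =
    birkhoffSum C.shift (fun ω => -Real.log (C.ratio (C.letter ω))) n ω - Real.log 2 := by
  induction n with
  | zero => intro ω; simp [radius]
  | succ n ih =>
    intro ω
    rw [birkhoffSum_succ', radius, Real.log_mul (C.ratio_pos _).ne' (C.radius_pos n _).ne',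
      neg_add, ih]
    ring

instance [IsProbabilityMeasure μ] : IsProbabilityMeasure C.meas :=
  Measure.isProbabilityMeasure_map C.measurable_coding.aemeasurable

instance [IsFiniteMeasure μ] (a : A) : IsFiniteMeasure (C.piece a) := by
  unfold piece; infer_instance

lemma piece_le (a : A) : C.piece a ≤ C.meas :=
  Measure.map_mono Measure.restrict_le_self C.measurable_coding

lemma measurable_radius [MeasurableSingletonClass A] [Countable A] (n : ℕ) :
    Measurable (C.radius n) := by
  induction n with
  | zero => exact measurable_const
  | succ n ih =>
    exact ((measurable_of_countable C.ratio).comp C.measurable_letter).mul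
      (ih.comp C.ergodic.measurable)

lemma measurable_letter_apply [MeasurableSingletonClass A] [Countable A] {β : Type*}
    [MeasurableSpace β] {F : A → Ω → β} (hF : ∀ a, Measurable (F a)) :
    Measurable fun ω => F (C.letter ω) ω := by
  have : Measurable fun p : A × Ω => F p.1 p.2 := measurable_from_prod_countable_right hF
  exact this.comp (C.measurable_letter.prodMk measurable_id)

lemma info_nonneg [IsProbabilityMeasure μ] (n : ℕ) (ω : Ω) : 0 ≤ C.info n ω := by
  have h : C.piece (C.letter ω) (C.ball n ω) / C.meas (C.ball n ω) ≤ 1 :=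
    ENNReal.div_le_of_le_mul (by rw [one_mul]; exact C.piece_le _ _)
  exact neg_nonneg.mpr (Real.log_nonpos ENNReal.toReal_nonneg
    (ENNReal.toReal_le_of_le_ofReal zero_le_one (by simpa using h)))

/-- This discards the orbits that meet a letter of probability zero, along which the logarithms
would take default values. -/
lemma ae_prob_ne_zero [MeasurableSingletonClass A] [Countable A] :
    ∀ᵐ ω ∂μ, ∀ k, μ (C.letter ⁻¹' {C.letter (C.shift^[k] ω)}) ≠ 0 := by
  have h1 : ∀ᵐ ω ∂μ, μ (C.letter ⁻¹' {C.letter ω}) ≠ 0 := by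
    have : {ω | ¬ μ (C.letter ⁻¹' {C.letter ω}) ≠ 0} ⊆
        ⋃ a ∈ {a | μ (C.letter ⁻¹' {a}) = 0}, C.letter ⁻¹' {a} := by
      intro ω hω
      simp only [Set.mem_iUnion]
      exact ⟨C.letter ω, not_not.mp hω, rfl⟩
    refine measure_mono_null this ?_
    exact (measure_biUnion_null_iff (Set.to_countable _)).mpr fun _ ha => ha
  exact ae_all_iff.mpr fun k =>
    (C.ergodic.toMeasurePreserving.iterate k).quasiMeasurePreserving.ae h1

variable [BorelSpace E]

/-- Among points with the letter of `ω`, distances of codes are those of the shifted codes scaled by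
the ratio. Lying in the ball thus becomes a condition on the shifted point, which is independent of
the letter. -/
lemma piece_closedBall [MeasurableSingletonClass A] (ω : Ω) (r : ℝ) :
    C.piece (C.letter ω) (Metric.closedBall (C.coding ω) (C.ratio (C.letter ω) * r)) =
      μ (C.letter ⁻¹' {C.letter ω}) * C.meas (Metric.closedBall (C.coding (C.shift ω)) r) := by
  have hl : MeasurableSet (C.letter ⁻¹' {C.letter ω}) :=
    C.measurable_letter (measurableSet_singleton _)
  rw [piece, meas, Measure.map_apply C.measurable_coding Metric.isClosed_closedBall.measurableSet,
    Measure.map_apply C.measurable_coding Metric.isClosed_closedBall.measurableSet,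
    Measure.restrict_apply (C.measurable_coding Metric.isClosed_closedBall.measurableSet),
    ← C.indep _ _ (C.measurable_coding Metric.isClosed_closedBall.measurableSet)]
  congr 1
  ext ω'
  simp only [Set.mem_inter_iff, Set.mem_preimage, Metric.mem_closedBall, Set.mem_singleton_iff]
  rw [and_comm]
  refine and_congr_right fun h => ?_
  rw [C.dist_coding ω' ω h, h, mul_le_mul_iff_right₀ (C.ratio_pos _)]

lemma piece_ball_succ [MeasurableSingletonClass A] (n : ℕ) (ω : Ω) :
    C.piece (C.letter ω) (C.ball (n + 1) ω) =
      μ (C.letter ⁻¹' {C.letter ω}) * C.meas (C.ball n (C.shift ω)) :=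
  C.piece_closedBall ω _

/-- This is why `radius` starts at `2`: any two codes are at distance at most `2`. -/
lemma meas_ball_zero [IsProbabilityMeasure μ] (ω : Ω) : C.meas (C.ball 0 ω) = 1 := by
  rw [meas, ball, Measure.map_apply C.measurable_coding Metric.isClosed_closedBall.measurableSet]
  convert measure_univ (μ := μ)
  exact Set.eq_univ_of_forall fun ω' => C.dist_coding_le ω' ω

lemma meas_ball_ne_zero [IsProbabilityMeasure μ] [MeasurableSingletonClass A] (n : ℕ) :
    ∀ ω, (∀ k, μ (C.letter ⁻¹' {C.letter (C.shift^[k] ω)}) ≠ 0) → C.meas (C.ball n ω) ≠ 0 := by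
  induction n with
  | zero => intro ω _; simp [C.meas_ball_zero]
  | succ n ih =>
    intro ω hω h0
    have h1 : C.piece (C.letter ω) (C.ball (n + 1) ω) ≤ 0 := h0 ▸ C.piece_le _ _
    rw [C.piece_ball_succ, nonpos_iff_eq_zero, mul_eq_zero] at h1
    exact h1.elim (hω 0) (ih _ fun k => hω (k + 1))

lemma neg_log_meas_ball_succ [IsProbabilityMeasure μ] [MeasurableSingletonClass A] (n : ℕ) (ω : Ω)
    (hω : ∀ k, μ (C.letter ⁻¹' {C.letter (C.shift^[k] ω)}) ≠ 0) :
    -Real.log (C.meas.real (C.ball (n + 1) ω)) = -Real.log (C.prob (C.letter ω)) -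
      C.info (n + 1) ω - Real.log (C.meas.real (C.ball n (C.shift ω))) := by
  have h1 : C.meas.real (C.ball (n + 1) ω) ≠ 0 :=
    (ENNReal.toReal_pos (C.meas_ball_ne_zero _ ω hω) (measure_ne_top _ _)).ne'
  have h2 : C.meas.real (C.ball n (C.shift ω)) ≠ 0 :=
    (ENNReal.toReal_pos (C.meas_ball_ne_zero _ _ fun k => hω (k + 1)) (measure_ne_top _ _)).ne'
  have h3 : C.prob (C.letter ω) ≠ 0 := (ENNReal.toReal_pos (hω 0) (measure_ne_top _ _)).ne'
  rw [info, C.piece_ball_succ, ENNReal.toReal_div, ENNReal.toReal_mul]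
  change _ = _ - -Real.log (C.prob _ * C.meas.real _ / C.meas.real _) - _
  rw [Real.log_div (mul_ne_zero h3 h2) h1, Real.log_mul h3 h2]
  ring

/-- Iterating the one-step identity produces `info` with decreasing index along the orbit, the form
of sum treated by Maker's theorem. -/
lemma neg_log_meas_ball [IsProbabilityMeasure μ] [MeasurableSingletonClass A] (n : ℕ) :
    ∀ ω, (∀ k, μ (C.letter ⁻¹' {C.letter (C.shift^[k] ω)}) ≠ 0) →
      -Real.log (C.meas.real (C.ball n ω)) =
        birkhoffSum C.shift (fun ω => -Real.log (C.prob (C.letter ω))) n ω -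
          ∑ k ∈ Finset.range n, C.info (n - k) (C.shift^[k] ω) := by
  induction n with
  | zero => intro ω _; simp [measureReal_def, C.meas_ball_zero]
  | succ n ih =>
    intro ω hω
    rw [C.neg_log_meas_ball_succ n ω hω, birkhoffSum_succ', Finset.sum_range_succ', sub_eq_add_neg,
      ih _ fun k => hω (k + 1)]
    simp only [Function.iterate_succ_apply, Nat.add_sub_add_right, Function.iterate_zero, id,
      Nat.sub_zero]
    ring

variable [SecondCountableTopology E]

lemma measurable_measure_ball [MeasurableSingletonClass A] [Countable A] (κ : Measure E)
    [SFinite κ] (n : ℕ) : Measurable fun ω => κ (C.ball n ω) := by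
  have hs : MeasurableSet {p : Ω × E | dist p.2 (C.coding p.1) ≤ C.radius n p.1} :=
    measurableSet_le (measurable_snd.dist (C.measurable_coding.comp measurable_fst))
      ((C.measurable_radius n).comp measurable_fst)
  exact measurable_measure_prodMk_left hs

lemma measurable_info [IsProbabilityMeasure μ] [MeasurableSingletonClass A] [Countable A]
    (n : ℕ) : Measurable (C.info n) :=
  (Real.measurable_log.comp (((C.measurable_letter_apply
    (F := fun a ω => C.piece a (C.ball n ω)) fun _ => C.measurable_measure_ball _ n).div
      (C.measurable_measure_ball _ n)).ennreal_toReal)).neg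

end SelfSimilarCoding

end

/-! ### Densities, integrability of the information and exact dimensionality -/

/-- A discrete layer-cake bound: for finite `x` the sum counts the naturals below `x`, of which
there are `⌈x⌉`. -/
lemma ENNReal.le_tsum_indicator_lt (x : ENNReal) :
    x ≤ ∑' k : ℕ, {y : ENNReal | (k : ENNReal) < y}.indicator 1 x := by
  rcases eq_or_ne x ⊤ with rfl | hx
  · simp
  · lift x to NNReal using hx
    refine le_trans ?_ (ENNReal.sum_le_tsum (Finset.range ⌈x⌉₊))
    rw [Finset.sum_congr rfl fun k hk => Set.indicator_of_mem (a := (x : ENNReal)) (by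
      have := Nat.lt_ceil.mp (Finset.mem_range.mp hk)
      simp only [Set.mem_ofPred_eq]
      exact_mod_cast this) 1]
    simp only [Pi.one_apply, Finset.sum_const, Finset.card_range, nsmul_eq_mul, mul_one]
    exact_mod_cast Nat.le_ceil x

noncomputable section

namespace SelfSimilarCoding

variable {Ω A E : Type*} [MeasurableSpace Ω] {μ : Measure Ω} [MeasurableSpace A] [MetricSpace E]
  [MeasurableSpace E] (C : SelfSimilarCoding μ A E)

lemma prob_nonneg (a : A) : 0 ≤ C.prob a := measureReal_nonneg

variable [IsProbabilityMeasure μ]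

lemma prob_le_one (a : A) : C.prob a ≤ 1 := measureReal_le_one

lemma neg_log_prob_nonneg (a : A) : 0 ≤ -Real.log (C.prob a) :=
  neg_nonneg.mpr (Real.log_nonpos (C.prob_nonneg a) (C.prob_le_one a))

lemma lintegral_neg_log_ratio_pos :
    0 < ∫⁻ ω, ENNReal.ofReal (-Real.log (C.ratio (C.letter ω))) ∂μ := by
  have hb : ∀ ω, -Real.log C.bound ≤ -Real.log (C.ratio (C.letter ω)) := fun ω =>
    neg_le_neg (Real.log_le_log (C.ratio_pos _) (C.ratio_le _))
  obtain ⟨ω⟩ := nonempty_of_isProbabilityMeasure μ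
  calc (0 : ENNReal) < ENNReal.ofReal (-Real.log C.bound) :=
        ENNReal.ofReal_pos.mpr (neg_pos.mpr (Real.log_neg (C.bound_pos ω) C.bound_lt_one))
    _ = ∫⁻ _, ENNReal.ofReal (-Real.log C.bound) ∂μ := by simp
    _ ≤ _ := lintegral_mono fun ω => ENNReal.ofReal_le_ofReal (hb ω)

variable [MeasurableSingletonClass A] [Countable A]

omit [IsProbabilityMeasure μ] in
lemma lintegral_eq_tsum_letter (f : Ω → ENNReal) :
    ∫⁻ ω, f ω ∂μ = ∑' a, ∫⁻ ω in C.letter ⁻¹' {a}, f ω ∂μ := by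
  rw [← lintegral_iUnion (fun a => C.measurable_letter (measurableSet_singleton a))]
  · rw [Set.iUnion_eq_univ_iff.mpr fun ω => ⟨C.letter ω, rfl⟩, setLIntegral_univ]
  · intro a b hab
    exact Set.disjoint_left.mpr fun ω ha hb => hab (Eq.trans (Eq.symm ha) hb)

omit [IsProbabilityMeasure μ] in
lemma lintegral_letter (f : A → ENNReal) :
    ∫⁻ ω, f (C.letter ω) ∂μ = ∑' a, f a * μ (C.letter ⁻¹' {a}) := by
  rw [C.lintegral_eq_tsum_letter]
  refine tsum_congr fun a => ?_
  rw [setLIntegral_congr_fun (g := fun _ => f a)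
    (C.measurable_letter (measurableSet_singleton a)) fun ω hω => congrArg f hω,
    setLIntegral_const]

lemma tsum_measure_letter : ∑' a, μ (C.letter ⁻¹' {a}) = 1 := by
  have := C.lintegral_letter fun _ => 1
  simpa using this.symm

lemma lintegral_neg_log_prob (hH : Summable fun a => Real.negMulLog (C.prob a)) :
    ∫⁻ ω, ENNReal.ofReal (-Real.log (C.prob (C.letter ω))) ∂μ =
      ENNReal.ofReal (∑' a, Real.negMulLog (C.prob a)) := by
  rw [C.lintegral_letter fun a => ENNReal.ofReal (-Real.log (C.prob a)),
    ENNReal.ofReal_tsum_of_nonneg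
      (fun a => Real.negMulLog_nonneg (C.prob_nonneg a) (C.prob_le_one a)) hH]
  refine tsum_congr fun a => ?_
  rw [← ofReal_measureReal, ← ENNReal.ofReal_mul
    (neg_nonneg.mpr (Real.log_nonpos (C.prob_nonneg a) (C.prob_le_one a)))]
  rw [Real.negMulLog, prob]
  congr 1
  ring

omit [IsProbabilityMeasure μ] in
lemma measurable_comp_letter {β : Type*} [MeasurableSpace β] (f : A → β) :
    Measurable fun ω => f (C.letter ω) :=
  (measurable_of_countable f).comp C.measurable_letter

lemma integrable_neg_log_prob (hH : Summable fun a => Real.negMulLog (C.prob a)) :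
    Integrable (fun ω => -Real.log (C.prob (C.letter ω))) μ := by
  refine ⟨(C.measurable_comp_letter fun a => -Real.log (C.prob a)).aestronglyMeasurable, ?_⟩
  rw [hasFiniteIntegral_iff_ofReal (ae_of_all _ fun ω => C.neg_log_prob_nonneg _),
    C.lintegral_neg_log_prob hH]
  exact ENNReal.ofReal_lt_top

lemma integral_neg_log_prob (hH : Summable fun a => Real.negMulLog (C.prob a)) :
    ∫ ω, -Real.log (C.prob (C.letter ω)) ∂μ = ∑' a, Real.negMulLog (C.prob a) := by
  rw [integral_eq_lintegral_of_nonneg_ae (ae_of_all _ fun ω => C.neg_log_prob_nonneg _)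
    (C.measurable_comp_letter fun a => -Real.log (C.prob a)).aestronglyMeasurable,
    C.lintegral_neg_log_prob hH, ENNReal.toReal_ofReal
      (tsum_nonneg fun a => Real.negMulLog_nonneg (C.prob_nonneg a) (C.prob_le_one a))]

/-- The density of the part of the projected measure coming from the letter of `ω`, at the code
of `ω`. -/
def density (ω : Ω) : ENNReal := (C.piece (C.letter ω)).rnDeriv C.meas (C.coding ω)

omit [IsProbabilityMeasure μ] in
lemma measurable_density : Measurable C.density :=
  C.measurable_letter_apply fun _ => (Measure.measurable_rnDeriv _ _).comp C.measurable_coding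

/-- If at most `K` letters `a` can code a point, the inverse density has integral at most `K`. -/
lemma lintegral_inv_density_le {F : A → Set E} (hFm : ∀ a, MeasurableSet (F a))
    (hF : ∀ ω, C.coding ω ∈ F (C.letter ω)) {K : ℕ} (hK : ∀ x, {a | x ∈ F a}.encard ≤ K) :
    ∫⁻ ω, (C.density ω)⁻¹ ∂μ ≤ K := by
  -- The measure `piece a` is carried by `F a`, so its density vanishes off `F a`.
  have hzero : ∀ a, ∀ᵐ x ∂C.meas, x ∉ F a → (C.piece a).rnDeriv C.meas x = 0 := by
    intro a
    have h1 : C.piece a (F a)ᶜ = 0 := by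
      rw [piece, Measure.map_apply C.measurable_coding (hFm a).compl,
        Measure.restrict_apply (C.measurable_coding (hFm a).compl)]
      convert measure_empty (μ := μ)
      refine Set.eq_empty_of_forall_notMem fun ω hω => hω.1 ?_
      have := hF ω
      rwa [show C.letter ω = a from hω.2] at this
    have h2 := Measure.setLIntegral_rnDeriv_le (μ := C.piece a) (ν := C.meas) (F a)ᶜ
    rw [h1, nonpos_iff_eq_zero, lintegral_eq_zero_iff (Measure.measurable_rnDeriv _ _)] at h2
    exact (ae_restrict_iff' (hFm a).compl).mp h2
  have hm : ∀ a, Measurable fun x => ((C.piece a).rnDeriv C.meas x)⁻¹ := fun a =>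
    (Measure.measurable_rnDeriv _ _).inv
  -- The integral over the letter `a` is one of the inverse density against `piece a`, that is, of
  -- density times inverse density against `meas`. This product is at most the indicator of `F a`,
  -- and the indicators sum to at most `K`.
  calc ∫⁻ ω, (C.density ω)⁻¹ ∂μ
      = ∑' a, ∫⁻ x, ((C.piece a).rnDeriv C.meas x)⁻¹ ∂C.piece a := by
        rw [C.lintegral_eq_tsum_letter]
        refine tsum_congr fun a => ?_
        refine Eq.trans ?_ (lintegral_map (hm a) C.measurable_coding).symm
        refine setLIntegral_congr_fun (C.measurable_letter (measurableSet_singleton a))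
          fun ω hω => ?_
        rw [density, show C.letter ω = a from hω]
    _ = ∑' a, ∫⁻ x, (C.piece a).rnDeriv C.meas x * ((C.piece a).rnDeriv C.meas x)⁻¹ ∂C.meas := by
        refine tsum_congr fun a => ?_
        have := lintegral_withDensity_eq_lintegral_mul C.meas
          (Measure.measurable_rnDeriv (C.piece a) C.meas) (hm a)
        rwa [Measure.withDensity_rnDeriv_eq (C.piece a) C.meas
          (Measure.absolutelyContinuous_of_le (C.piece_le a))] at this
    _ ≤ ∑' a, ∫⁻ x, (F a).indicator 1 x ∂C.meas := by
        refine ENNReal.tsum_le_tsum fun a => lintegral_mono_ae ?_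
        filter_upwards [hzero a] with x hx
        by_cases hxF : x ∈ F a
        · simp [hxF, ENNReal.mul_inv_le_one]
        · simp [hxF, hx hxF]
    _ = ∫⁻ x, ∑' a, (F a).indicator 1 x ∂C.meas :=
        (lintegral_tsum fun a => (measurable_const.indicator (hFm a)).aemeasurable).symm
    _ ≤ ∫⁻ _, K ∂C.meas := by
        refine lintegral_mono fun x => ?_
        have h1 : ∑' a, (F a).indicator (1 : E → ENNReal) x =
            ∑' a, {a | x ∈ F a}.indicator (1 : A → ENNReal) a :=
          tsum_congr fun a => by by_cases h : x ∈ F a <;> simp [h]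
        rw [h1, ← tsum_subtype]
        simp only [Pi.one_apply, ENNReal.tsum_one]
        have := ENat.toENNReal_mono (hK x)
        simpa using this
    _ = K := by simp

variable [SecondCountableTopology E] [BorelSpace E] [HasBesicovitchCovering E]

-- Besicovitch differentiation holds off one null set for all of the countably many pieces. A
-- nonzero density is what allows passing to logarithms.
omit [MeasurableSingletonClass A] in
lemma ae_tendsto_info (hpos : ∀ᵐ ω ∂μ, C.density ω ≠ 0) :
    ∀ᵐ ω ∂μ, Tendsto (fun n => C.info n ω) atTop (𝓝 (-Real.log (C.density ω).toReal)) := by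
  have h1 : ∀ᵐ ω ∂μ, ∀ a, Tendsto (fun r => C.piece a (Metric.closedBall (C.coding ω) r) /
      C.meas (Metric.closedBall (C.coding ω) r)) (𝓝[>] 0)
      (𝓝 ((C.piece a).rnDeriv C.meas (C.coding ω))) :=
    ae_all_iff.mpr fun a => ae_of_ae_map C.measurable_coding.aemeasurable
      (Besicovitch.ae_tendsto_rnDeriv (C.piece a) C.meas)
  have h2 : ∀ᵐ ω ∂μ, ∀ a, (C.piece a).rnDeriv C.meas (C.coding ω) < ⊤ :=
    ae_all_iff.mpr fun a => ae_of_ae_map C.measurable_coding.aemeasurable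
      (Measure.rnDeriv_lt_top (C.piece a) C.meas)
  filter_upwards [h1, h2, hpos] with ω hω1 hω2 hω3
  have hr : Tendsto (fun n => C.radius n ω) atTop (𝓝[>] 0) :=
    tendsto_nhdsWithin_iff.mpr
      ⟨C.tendsto_radius ω, Eventually.of_forall fun n => C.radius_pos n ω⟩
  have h := (ENNReal.tendsto_toReal (hω2 (C.letter ω)).ne).comp ((hω1 (C.letter ω)).comp hr)
  exact (h.log (ENNReal.toReal_pos hω3 (hω2 _).ne).ne').neg

-- If `info n ω` exceeds `k - log (prob a)`, then `piece a` has less than the proportion `prob a *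
-- exp (-k)` of the ball. The maximal inequality with `t = exp k / prob a` bounds the set of such
-- points. Normalising by `log (prob a)` makes the bound proportional to the probability of `a`,
-- hence summable over infinitely many letters.
omit [Countable A] in
lemma measure_lt_info_add_log_prob_le : ∃ N : ℕ, ∀ (a : A) (k : ℕ), C.prob a ≠ 0 →
    μ (C.letter ⁻¹' {a} ∩ {ω | (k : ENNReal) <
      ⨆ n, ENNReal.ofReal (C.info n ω + Real.log (C.prob a))}) ≤
      N * ENNReal.ofReal (Real.exp (-k)) * μ (C.letter ⁻¹' {a}) := by
  obtain ⟨N, hN⟩ := exists_mul_measure_le_of_closedBall E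
  refine ⟨N, fun a k ha => ?_⟩
  have hP : 0 < C.prob a := lt_of_le_of_ne (C.prob_nonneg a) ha.symm
  let t : ENNReal := ENNReal.ofReal (Real.exp k / C.prob a)
  let S : Set E := {x | ∃ r, 0 < r ∧ r ≤ 2 ∧
    t * C.piece a (Metric.closedBall x r) ≤ C.meas (Metric.closedBall x r)}
  have hS : t * C.piece a S ≤ N * C.meas Set.univ := hN _ _ t S 2 fun x hx => hx
  have hsub : C.letter ⁻¹' {a} ∩ {ω | (k : ENNReal) <
      ⨆ n, ENNReal.ofReal (C.info n ω + Real.log (C.prob a))} ⊆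
        C.coding ⁻¹' S ∩ C.letter ⁻¹' {a} := by
    rintro ω ⟨hωa, hω⟩
    refine ⟨?_, hωa⟩
    obtain ⟨n, hn⟩ := lt_iSup_iff.mp (show (k : ENNReal) < ⨆ n, _ from hω)
    refine ⟨C.radius n ω, C.radius_pos n ω, C.radius_le_two n ω, ?_⟩
    change t * C.piece a (C.ball n ω) ≤ C.meas (C.ball n ω)
    -- When the piece gives the ball no mass, `info` has only a default value, but the inequality is
    -- trivial.
    rcases eq_or_ne (C.piece a (C.ball n ω)) 0 with h0 | h0
    · simp [h0]
    have hm0 : C.meas (C.ball n ω) ≠ 0 := fun h => h0 (le_antisymm (h ▸ C.piece_le a _) bot_le)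
    have hu := ENNReal.toReal_pos h0 (measure_ne_top _ _)
    have hv := ENNReal.toReal_pos hm0 (measure_ne_top _ _)
    rw [← ENNReal.ofReal_natCast, ENNReal.ofReal_lt_ofReal_iff', info,
      show C.letter ω = a from hωa, ENNReal.toReal_div] at hn
    have h1 : Real.log ((C.piece a (C.ball n ω)).toReal / (C.meas (C.ball n ω)).toReal) <
        Real.log (C.prob a) - k := by linarith [hn.1]
    have h2 := (Real.log_lt_iff_lt_exp (div_pos hu hv)).mp h1
    rw [Real.exp_sub, Real.exp_log hP, div_lt_div_iff₀ hv (Real.exp_pos _)] at h2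
    rw [← ENNReal.ofReal_toReal (measure_ne_top (C.piece a) _),
      ← ENNReal.ofReal_toReal (measure_ne_top C.meas (C.ball n ω)),
      ← ENNReal.ofReal_mul (by positivity)]
    refine ENNReal.ofReal_le_ofReal ?_
    rw [div_mul_eq_mul_div, div_le_iff₀ hP]
    linarith
  have ht : t * (ENNReal.ofReal (Real.exp (-k)) * μ (C.letter ⁻¹' {a})) = 1 := by
    rw [← ofReal_measureReal, ← ENNReal.ofReal_mul (Real.exp_nonneg _),
      ← ENNReal.ofReal_mul (by positivity), ← ENNReal.ofReal_one]
    congr 1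
    change Real.exp k / C.prob a * (Real.exp (-k) * C.prob a) = 1
    rw [Real.exp_neg]
    field_simp
  calc μ (C.letter ⁻¹' {a} ∩ {ω | (k : ENNReal) <
        ⨆ n, ENNReal.ofReal (C.info n ω + Real.log (C.prob a))})
      ≤ μ (C.coding ⁻¹' S ∩ C.letter ⁻¹' {a}) := measure_mono hsub
    _ = (μ.restrict (C.letter ⁻¹' {a})) (C.coding ⁻¹' S) :=
        (Measure.restrict_apply' (C.measurable_letter (measurableSet_singleton a))).symm
    -- `S` is not known to be measurable; one inequality for the pushforward is enough.
    _ ≤ C.piece a S := Measure.le_map_apply C.measurable_coding.aemeasurable S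
    _ = (t * C.piece a S) * (ENNReal.ofReal (Real.exp (-k)) * μ (C.letter ⁻¹' {a})) := by
        rw [mul_right_comm, ht, one_mul]
    _ ≤ (N * C.meas Set.univ) * (ENNReal.ofReal (Real.exp (-k)) * μ (C.letter ⁻¹' {a})) := by
        gcongr
    _ = N * ENNReal.ofReal (Real.exp (-k)) * μ (C.letter ⁻¹' {a}) := by
        rw [measure_univ, mul_one, mul_assoc]

/-- On the letter `a`, the supremum is at most the supremum of `info + log (prob a)`, whose tails
decay exponentially, plus `-log (prob a)`, which sums to the entropy. This is the domination
required by Maker's theorem. -/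
lemma lintegral_iSup_info_lt_top (hH : Summable fun a => Real.negMulLog (C.prob a)) :
    ∫⁻ ω, ⨆ n, ENNReal.ofReal (C.info n ω) ∂μ < ⊤ := by
  obtain ⟨N, hN⟩ := C.measure_lt_info_add_log_prob_le
  have hle : ∀ a, ∫⁻ ω in C.letter ⁻¹' {a}, ⨆ n, ENNReal.ofReal (C.info n ω) ∂μ ≤
      N * (∑' k : ℕ, ENNReal.ofReal (Real.exp (-k))) * μ (C.letter ⁻¹' {a}) +
        ENNReal.ofReal (-Real.log (C.prob a)) * μ (C.letter ⁻¹' {a}) := by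
    intro a
    have hla : MeasurableSet (C.letter ⁻¹' {a}) := C.measurable_letter (measurableSet_singleton a)
    rcases eq_or_ne (C.prob a) 0 with h0 | h0
    · have : μ (C.letter ⁻¹' {a}) = 0 := (measureReal_eq_zero_iff).mp h0
      rw [setLIntegral_measure_zero _ _ this]
      exact bot_le
    let V : Ω → ENNReal := fun ω => ⨆ n, ENNReal.ofReal (C.info n ω + Real.log (C.prob a))
    have hV : Measurable V := Measurable.iSup fun n =>
      ((C.measurable_info n).add_const _).ennreal_ofReal
    have hkm : ∀ k : ℕ, MeasurableSet {y : ENNReal | (k : ENNReal) < y} := fun k =>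
      measurableSet_Ioi
    calc ∫⁻ ω in C.letter ⁻¹' {a}, ⨆ n, ENNReal.ofReal (C.info n ω) ∂μ
        ≤ ∫⁻ ω in C.letter ⁻¹' {a}, (V ω + ENNReal.ofReal (-Real.log (C.prob a))) ∂μ := by
          refine lintegral_mono fun ω => iSup_le fun n => ?_
          calc ENNReal.ofReal (C.info n ω) = ENNReal.ofReal
                (C.info n ω + Real.log (C.prob a) + -Real.log (C.prob a)) := by congr 1; ring
            _ ≤ _ := ENNReal.ofReal_add_le
            _ ≤ V ω + ENNReal.ofReal (-Real.log (C.prob a)) := by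
                gcongr
                exact le_iSup (fun n => ENNReal.ofReal (C.info n ω + Real.log (C.prob a))) n
      _ = ∫⁻ ω in C.letter ⁻¹' {a}, V ω ∂μ +
            ENNReal.ofReal (-Real.log (C.prob a)) * μ (C.letter ⁻¹' {a}) := by
          rw [lintegral_add_right _ measurable_const, setLIntegral_const]
      _ ≤ _ := by
          gcongr
          calc ∫⁻ ω in C.letter ⁻¹' {a}, V ω ∂μ
              ≤ ∫⁻ ω in C.letter ⁻¹' {a},
                  ∑' k : ℕ, {y : ENNReal | (k : ENNReal) < y}.indicator 1 (V ω) ∂μ :=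
                lintegral_mono fun ω => ENNReal.le_tsum_indicator_lt _
            _ = ∑' k : ℕ, ∫⁻ ω in C.letter ⁻¹' {a},
                  {y : ENNReal | (k : ENNReal) < y}.indicator 1 (V ω) ∂μ :=
                lintegral_tsum fun k =>
                  ((measurable_one.indicator (hkm k)).comp hV).aemeasurable
            _ ≤ ∑' k : ℕ, N * ENNReal.ofReal (Real.exp (-k)) * μ (C.letter ⁻¹' {a}) := by
                refine ENNReal.tsum_le_tsum fun k => ?_
                refine le_trans (le_of_eq ?_) (hN a k h0)
                have : ∀ ω, {y : ENNReal | (k : ENNReal) < y}.indicator (1 : ENNReal → ENNReal)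
                    (V ω) = (V ⁻¹' {y : ENNReal | (k : ENNReal) < y}).indicator 1 ω := fun ω => rfl
                simp only [this]
                rw [lintegral_indicator_one (hV (hkm k)), Measure.restrict_apply (hV (hkm k)),
                  Set.inter_comm]
                rfl
            _ = _ := by rw [ENNReal.tsum_mul_right, ENNReal.tsum_mul_left]
  rw [C.lintegral_eq_tsum_letter]
  refine (ENNReal.tsum_le_tsum hle).trans_lt ?_
  rw [ENNReal.tsum_add, ENNReal.tsum_mul_left, C.tsum_measure_letter,
    ← C.lintegral_letter fun a => ENNReal.ofReal (-Real.log (C.prob a)),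
    C.lintegral_neg_log_prob hH, mul_one]
  refine ENNReal.add_lt_top.mpr ⟨ENNReal.mul_lt_top (ENNReal.natCast_lt_top N) ?_,
    ENNReal.ofReal_lt_top⟩
  rw [← ENNReal.ofReal_tsum_of_nonneg (fun k => Real.exp_nonneg _) Real.summable_exp_neg_nat]
  exact ENNReal.ofReal_lt_top

/-- The measure of the balls `ball n ω` decays exponentially, at a rate between `H - log K` and
the entropy `H` of the letters. -/
theorem exists_tendsto_neg_log_meas_ball (hH : Summable fun a => Real.negMulLog (C.prob a))
    {F : A → Set E} (hFm : ∀ a, MeasurableSet (F a)) (hF : ∀ ω, C.coding ω ∈ F (C.letter ω))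
    {K : ℕ} (hK0 : 0 < K) (hK : ∀ x, {a | x ∈ F a}.encard ≤ K) :
    ∃ h : ℝ, ∑' a, Real.negMulLog (C.prob a) - Real.log K ≤ h ∧
      h ≤ ∑' a, Real.negMulLog (C.prob a) ∧
      ∀ᵐ ω ∂μ, Tendsto (fun n : ℕ => -Real.log (C.meas.real (C.ball n ω)) / n) atTop (𝓝 h) := by
  have hinv := C.lintegral_inv_density_le hFm hF hK
  have hinv' : ∫⁻ ω, (C.density ω)⁻¹ ∂μ ≠ ⊤ := (hinv.trans_lt (ENNReal.natCast_lt_top K)).ne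
  have hinvm : Measurable fun ω => (C.density ω)⁻¹ := C.measurable_density.inv
  -- An inverse density with finite integral is almost everywhere finite.
  have hpos : ∀ᵐ ω ∂μ, C.density ω ≠ 0 := by
    filter_upwards [ae_lt_top hinvm hinv'] with ω hω h0
    simp [h0] at hω
  have hlim := C.ae_tendsto_info hpos
  let g : Ω → ℝ := fun ω => -Real.log (C.density ω).toReal
  have hgm : Measurable g := (Real.measurable_log.comp C.measurable_density.ennreal_toReal).neg
  have hΨlt := C.lintegral_iSup_info_lt_top hH
  have hΨm : Measurable fun ω => ⨆ n, ENNReal.ofReal (C.info n ω) :=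
    Measurable.iSup fun n => (C.measurable_info n).ennreal_ofReal
  have hΨi := integrable_toReal_of_lintegral_ne_top hΨm.aemeasurable hΨlt.ne
  have hdom : ∀ᵐ ω ∂μ, ∀ n, |C.info n ω| ≤ (⨆ n, ENNReal.ofReal (C.info n ω)).toReal := by
    filter_upwards [ae_lt_top hΨm hΨlt.ne] with ω hω n
    rw [abs_of_nonneg (C.info_nonneg n ω)]
    exact (ENNReal.ofReal_le_iff_le_toReal hω.ne).mp
      (le_iSup (fun n => ENNReal.ofReal (C.info n ω)) n)
  have hmaker := ae_tendsto_average_of_dominated C.ergodic C.measurable_info hgm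
    hΨm.ennreal_toReal hΨi hdom hlim
  have hbirk := ae_tendsto_birkhoffAverage C.ergodic
    (C.measurable_comp_letter fun a => -Real.log (C.prob a)) (C.integrable_neg_log_prob hH)
  rw [C.integral_neg_log_prob hH] at hbirk
  have hg0 : ∀ᵐ ω ∂μ, 0 ≤ g ω := by
    filter_upwards [hlim] with ω hω
    exact ge_of_tendsto' hω fun n => C.info_nonneg n ω
  have hgi : Integrable g μ := by
    refine hΨi.mono' hgm.aestronglyMeasurable ?_
    filter_upwards [hlim, hdom] with ω h1 h2
    exact le_of_tendsto' h1.abs h2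
  -- Jensen's inequality in explicit form: apply `log t ≤ t - 1` to `t = 1 / (K * density)` and
  -- integrate, using that the inverse density has integral at most `K`.
  have hgK : ∫ ω, g ω ∂μ ≤ Real.log K := by
    have hKpos : (0 : ℝ) < K := by exact_mod_cast hK0
    have hui := integrable_toReal_of_lintegral_ne_top hinvm.aemeasurable hinv'
    have hu : ∫ ω, ((C.density ω)⁻¹).toReal ∂μ ≤ K := by
      rw [integral_toReal hinvm.aemeasurable
        (ae_lt_top hinvm hinv')]
      exact ENNReal.toReal_le_of_le_ofReal hKpos.le (by simpa using hinv)
    calc ∫ ω, g ω ∂μ ≤ ∫ ω, ((Real.log K - 1) + (K : ℝ)⁻¹ * ((C.density ω)⁻¹).toReal) ∂μ := by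
          refine integral_mono_ae hgi ((integrable_const _).add (hui.const_mul _)) ?_
          have hfin : ∀ᵐ ω ∂μ, ∀ a, (C.piece a).rnDeriv C.meas (C.coding ω) < ⊤ :=
            ae_all_iff.mpr fun a => ae_of_ae_map C.measurable_coding.aemeasurable
              (Measure.rnDeriv_lt_top (C.piece a) C.meas)
          filter_upwards [hpos, hfin] with ω h1 h2
          have hd : 0 < (C.density ω).toReal := ENNReal.toReal_pos h1 (h2 _).ne
          have h3 := Real.log_le_sub_one_of_pos (mul_pos (inv_pos.mpr hKpos) (inv_pos.mpr hd))
          rw [Real.log_mul (inv_pos.mpr hKpos).ne' (inv_pos.mpr hd).ne', Real.log_inv,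
            Real.log_inv] at h3
          simp only [g, ENNReal.toReal_inv]
          linarith
      _ = (Real.log K - 1) + (K : ℝ)⁻¹ * ∫ ω, ((C.density ω)⁻¹).toReal ∂μ := by
          rw [integral_add (integrable_const _) (hui.const_mul _), integral_const_mul]
          simp
      _ ≤ (Real.log K - 1) + (K : ℝ)⁻¹ * K := by gcongr
      _ = Real.log K := by field_simp; ring
  refine ⟨∑' a, Real.negMulLog (C.prob a) - ∫ ω, g ω ∂μ, by linarith,
    by linarith [integral_nonneg_of_ae hg0], ?_⟩
  filter_upwards [hmaker, hbirk, C.ae_prob_ne_zero] with ω h1 h2 h3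
  refine (h2.sub h1).congr fun n => ?_
  rw [C.neg_log_meas_ball n ω h3, birkhoffAverage, smul_eq_mul, sub_div, ← div_eq_inv_mul]

omit [SecondCountableTopology E] [BorelSpace E] [HasBesicovitchCovering E] in
lemma ae_tendsto_div_neg_log_radius :
    ∀ᵐ ω ∂μ, Tendsto (fun n : ℕ => (n : ℝ) / -Real.log (C.radius n ω)) atTop
      (𝓝 (∫⁻ ω, ENNReal.ofReal (-Real.log (C.ratio (C.letter ω))) ∂μ).toReal⁻¹) := by
  have hm := C.measurable_comp_letter fun a => -Real.log (C.ratio a)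
  have h0 : ∀ ω, 0 ≤ -Real.log (C.ratio (C.letter ω)) := fun ω =>
    neg_nonneg.mpr (Real.log_nonpos (C.ratio_pos _).le
      ((C.ratio_le _).trans C.bound_lt_one.le))
  have hlog2 : Tendsto (fun n : ℕ => Real.log 2 / (n : ℝ)) atTop (𝓝 0) :=
    tendsto_const_div_atTop_nhds_zero_nat _
  have heq : ∀ ω (n : ℕ), ((n : ℝ) / -Real.log (C.radius n ω)) =
      (birkhoffAverage ℝ C.shift (fun ω => -Real.log (C.ratio (C.letter ω))) n ω -
        Real.log 2 / n)⁻¹ := by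
    intro ω n
    rw [C.neg_log_radius, birkhoffAverage, smul_eq_mul, ← div_eq_inv_mul, ← sub_div, inv_div]
  simp only [heq]
  rcases eq_or_ne (∫⁻ ω, ENNReal.ofReal (-Real.log (C.ratio (C.letter ω))) ∂μ) ⊤ with htop | htop
  · filter_upwards [ae_tendsto_birkhoffAverage_atTop C.ergodic hm h0 htop] with ω hω
    -- For an infinite mean, the default value `⊤.toReal⁻¹ = 0` is the true limit.
    rw [htop, ENNReal.toReal_top, inv_zero]
    simp only [sub_eq_add_neg]
    exact (hω.atTop_add hlog2.neg).inv_tendsto_atTop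
  · have hi : Integrable (fun ω => -Real.log (C.ratio (C.letter ω))) μ := by
      refine ⟨hm.aestronglyMeasurable, ?_⟩
      rw [hasFiniteIntegral_iff_ofReal (ae_of_all _ h0)]
      exact htop.lt_top
    filter_upwards [ae_tendsto_birkhoffAverage C.ergodic hm hi] with ω hω
    have h1 := hω.sub hlog2
    rw [sub_zero, integral_eq_lintegral_of_nonneg_ae (ae_of_all _ h0) hm.aestronglyMeasurable] at h1
    exact h1.inv₀ (ENNReal.toReal_pos C.lintegral_neg_log_ratio_pos.ne' htop).ne'

/-- The projected measure is exact dimensional. -/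
theorem exists_hasPointwiseDimension (hH : Summable fun a => Real.negMulLog (C.prob a))
    {F : A → Set E} (hFm : ∀ a, MeasurableSet (F a)) (hF : ∀ ω, C.coding ω ∈ F (C.letter ω))
    {K : ℕ} (hK0 : 0 < K) (hK : ∀ x, {a | x ∈ F a}.encard ≤ K) :
    ∃ h : ℝ, ∑' a, Real.negMulLog (C.prob a) - Real.log K ≤ h ∧
      h ≤ ∑' a, Real.negMulLog (C.prob a) ∧
      ∀ᵐ ω ∂μ, RandomDiskIFS.HasPointwiseDimension (μ.map C.coding) (C.coding ω)
        (h / (∫⁻ ω, ENNReal.ofReal (-Real.log (C.ratio (C.letter ω))) ∂μ).toReal) := by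
  obtain ⟨h, hl, hu, hae⟩ := C.exists_tendsto_neg_log_meas_ball hH hFm hF hK0 hK
  refine ⟨h, hl, hu, ?_⟩
  filter_upwards [hae, C.ae_tendsto_div_neg_log_radius, C.ae_prob_ne_zero] with ω h1 h2 h3
  have hU : ∀ n, 0 < C.meas.real (C.ball n ω) := fun n =>
    ENNReal.toReal_pos (C.meas_ball_ne_zero n ω h3) (measure_ne_top _ _)
  refine ⟨fun r hr => ?_, ?_⟩
  · obtain ⟨n, hn⟩ := ((C.tendsto_radius ω).eventually (gt_mem_nhds hr)).exists
    exact (pos_iff_ne_zero.mpr (C.meas_ball_ne_zero n ω h3)).trans_le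
      (measure_mono (Metric.closedBall_subset_ball hn))
  · rw [div_eq_mul_inv]
    refine tendsto_log_div_log_of_seq (U := fun n => C.meas.real (C.ball n ω)) hU
      (fun n => measureReal_le_one) (fun n => C.radius_pos n ω) (C.tendsto_radius ω) ?_ h1 h2
    intro n r hr1 hr2
    exact ⟨measureReal_mono (Metric.closedBall_subset_ball hr1),
      measureReal_mono ((Metric.ball_subset_closedBall).trans
        (Metric.closedBall_subset_closedBall hr2))⟩

end SelfSimilarCoding

end

/-! ### Rigidity of the parameter dynamics: the square is the identity and the entropy is zero -/

/-- A strictly increasing map which preserves a finite measure is the identity almost everywhere. -/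
theorem StrictMono.ae_eq_id_of_measurePreserving {α : Type*} [LinearOrder α] [TopologicalSpace α]
    [OrderTopology α] [DenselyOrdered α] [TopologicalSpace.SeparableSpace α] [MeasurableSpace α]
    [OpensMeasurableSpace α] {m : Measure α} [IsFiniteMeasure m] {g : α → α} (hg : StrictMono g)
    (hgm : MeasurePreserving g m m) : ∀ᵐ x ∂m, g x = x := by
  -- The segment below `q` and its preimage have equal measure, and by monotonicity one contains the
  -- other, so they differ by a null set. A point with `g x ≠ x` is detected by some `q` in a
  -- countable dense set.
  have key : ∀ q, m {x | x ≤ q ∧ q < g x} = 0 ∧ m {x | g x ≤ q ∧ q < x} = 0 := by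
    intro q
    have hB : MeasurableSet {x | x ≤ q} := measurableSet_Iic
    have hA : MeasurableSet {x | g x ≤ q} := hgm.measurable hB
    have heq : m {x | g x ≤ q} = m {x | x ≤ q} := hgm.measure_preimage hB.nullMeasurableSet
    have hd1 : {x | x ≤ q ∧ q < g x} = {x | x ≤ q} \ {x | g x ≤ q} := by ext; simp
    have hd2 : {x | g x ≤ q ∧ q < x} = {x | g x ≤ q} \ {x | x ≤ q} := by ext; simp
    rw [hd1, hd2]
    rcases le_total (g q) q with h | h
    · have hsub : {x | x ≤ q} ⊆ {x | g x ≤ q} := fun x hx => (hg.monotone hx).trans h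
      refine ⟨by rw [Set.sdiff_eq_empty.mpr hsub, measure_empty], ?_⟩
      rw [measure_sdiff hsub hB.nullMeasurableSet (measure_ne_top _ _), heq, tsub_self]
    · have hsub : {x | g x ≤ q} ⊆ {x | x ≤ q} := fun x hx => hg.le_iff_le.mp (le_trans hx h)
      refine ⟨?_, by rw [Set.sdiff_eq_empty.mpr hsub, measure_empty]⟩
      rw [measure_sdiff hsub hA.nullMeasurableSet (measure_ne_top _ _), heq, tsub_self]
  obtain ⟨s, hsc, hsd⟩ := TopologicalSpace.exists_countable_dense α
  have h1 : ∀ᵐ x ∂m, ∀ q ∈ s, ¬(x ≤ q ∧ q < g x) :=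
    (ae_ball_iff hsc).mpr fun q _ => by
      rw [ae_iff]
      simpa using (key q).1
  have h2 : ∀ᵐ x ∂m, ∀ q ∈ s, ¬(g x ≤ q ∧ q < x) :=
    (ae_ball_iff hsc).mpr fun q _ => by
      rw [ae_iff]
      simpa using (key q).2
  filter_upwards [h1, h2] with x hx1 hx2
  rcases lt_trichotomy (g x) x with h | h | h
  · obtain ⟨q, hq, hq1, hq2⟩ := hsd.exists_between h
    exact (hx2 q hq ⟨hq1.le, hq2⟩).elim
  · exact h
  · obtain ⟨q, hq, hq1, hq2⟩ := hsd.exists_between h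
    exact (hx1 q hq ⟨hq1.le, hq2⟩).elim

namespace RandomDiskIFS

/-- The square of a homeomorphism of the parameter interval that preserves a finite measure is the
identity almost everywhere. -/
lemma ae_involutive_of_measurePreserving {ε : ℝ} (hε : 0 < ε) (θ : Param ε ≃ₜ Param ε)
    {m : Measure (Param ε)} [IsFiniteMeasure m] (hθ : MeasurePreserving θ m m) :
    ∀ᵐ l ∂m, θ (θ l) = l := by
  have : Fact (1 - ε ≤ 1 + ε) := ⟨by linarith⟩
  refine StrictMono.ae_eq_id_of_measurePreserving (g := fun l => θ (θ l)) ?_ (hθ.comp hθ)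
  -- Increasing or decreasing, the square is increasing.
  rcases θ.continuous.strictMono_of_inj_boundedOrder' θ.injective with h | h
  · exact h.comp h
  · exact h.comp h

lemma partitionEntropy_nonneg {α ι : Type*} [MeasurableSpace α] [Fintype ι] (m : Measure α)
    [IsProbabilityMeasure m] (f : α → ι) : 0 ≤ partitionEntropy m f :=
  Finset.sum_nonneg fun _ _ => Real.negMulLog_nonneg measureReal_nonneg measureReal_le_one

/-- The crude bound of `1` per atom replaces the logarithm of the number of atoms; any bound
independent of the length of the join disappears after division by `n`. -/
lemma partitionEntropy_le_card {α ι : Type*} [MeasurableSpace α] [Fintype ι] (m : Measure α)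
    [IsProbabilityMeasure m] (f : α → ι) (s : Finset ι) (hs : ∀ᵐ x ∂m, f x ∈ s) :
    partitionEntropy m f ≤ s.card := by
  classical
  have h0 : ∀ i ∉ s, Real.negMulLog (m.real (f ⁻¹' {i})) = 0 := by
    intro i hi
    have : m (f ⁻¹' {i}) = 0 := by
      refine measure_mono_null ?_ (ae_iff.mp hs)
      rintro x rfl
      exact hi
    rw [measureReal_def, this, ENNReal.toReal_zero, Real.negMulLog_zero]
  rw [partitionEntropy, ← Finset.sum_subset (Finset.subset_univ s) fun i _ hi => h0 i hi]
  calc ∑ i ∈ s, Real.negMulLog (m.real (f ⁻¹' {i})) ≤ ∑ i ∈ s, (1 : ℝ) := by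
        refine Finset.sum_le_sum fun i _ => ?_
        have h1 : 0 ≤ m.real (f ⁻¹' {i}) := measureReal_nonneg
        linarith [Real.negMulLog_le_one_sub_self h1]
    _ = s.card := by simp

/-- A transformation whose square is the identity almost everywhere has entropy zero. -/
theorem measureEntropy_eq_zero {α : Type*} [MeasurableSpace α] (m : Measure α)
    [IsProbabilityMeasure m] {T : α → α} (hT : ∀ᵐ x ∂m, T (T x) = x) :
    measureEntropy m T = 0 := by
  refine le_antisymm (iSup₂_le fun k f => ?_) ?_
  · have hlim : Tendsto (fun n : ℕ => (((k * k : ℕ) / n : ℝ) : EReal)) atTop (𝓝 ((0 : ℝ) : EReal)) :=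
      (continuous_coe_real_ereal.tendsto 0).comp (tendsto_const_div_atTop_nhds_zero_nat _)
    rw [← EReal.coe_zero, ← hlim.limsup_eq]
    refine limsup_le_limsup (Eventually.of_forall fun n => ?_)
    refine EReal.coe_le_coe_iff.mpr (div_le_div_of_nonneg_right ?_ n.cast_nonneg)
    classical
    -- Almost every itinerary alternates between `f x` and `f (T x)`, so the join has at most `k *
    -- k` atoms of positive measure, for every `n`.
    let c : Fin k × Fin k → Fin n → Fin k := fun p j => if Even (j : ℕ) then p.1 else p.2
    refine (partitionEntropy_le_card m _ (Finset.univ.image c) ?_).trans ?_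
    · filter_upwards [hT] with x hx
      refine Finset.mem_image.mpr ⟨(f.1 x, f.1 (T x)), Finset.mem_univ _, funext fun j => ?_⟩
      have h2 : T^[2] x = x := hx
      have heven : ∀ i, T^[2 * i] x = x := fun i => by
        rw [Function.iterate_mul]
        exact Function.iterate_fixed h2 i
      rcases Nat.even_or_odd' (j : ℕ) with ⟨i, hi | hi⟩
      · simp [c, hi, heven]
      · simp only [c, hi, Function.iterate_succ_apply']
        rw [heven, if_neg (Nat.not_even_iff_odd.mpr (odd_two_mul_add_one i))]
    · have := Finset.card_image_le (s := (Finset.univ : Finset (Fin k × Fin k))) (f := c)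
      rw [Finset.card_univ, Fintype.card_prod, Fintype.card_fin] at this
      exact_mod_cast this
  · refine le_iSup₂_of_le 1 ⟨fun _ => 0, measurable_const⟩ ?_
    refine le_limsup_of_frequently_le (Frequently.of_forall fun n => ?_)
    exact EReal.coe_nonneg.mpr (div_nonneg (partitionEntropy_nonneg _ _) n.cast_nonneg)

end RandomDiskIFS

/-! ### The Bernoulli shift by two places -/

section Bernoulli

open ProbabilityTheory

variable {A : Type*} [MeasurableSpace A]

/-- The shift by two places. -/
def shiftTwo (ω : ℕ → A) : ℕ → A := fun k => ω (k + 2)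

omit [MeasurableSpace A] in
lemma iterate_shiftTwo (n : ℕ) : ∀ ω : ℕ → A, shiftTwo^[n] ω = fun k => ω (k + 2 * n) := by
  induction n with
  | zero => intro ω; rfl
  | succ n ih =>
    intro ω
    rw [Function.iterate_succ_apply, ih]
    rfl

/-- The σ-algebra of the coordinate `i`. -/
abbrev coordinateSigma (A : Type*) [MeasurableSpace A] (i : ℕ) : MeasurableSpace (ℕ → A) :=
  MeasurableSpace.comap (fun ω => ω i) inferInstance

lemma coordinateSigma_le (i : ℕ) : coordinateSigma A i ≤ MeasurableSpace.pi :=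
  (measurable_pi_apply i).comap_le

lemma iIndep_coordinateSigma (p : Measure A) [IsProbabilityMeasure p] :
    iIndep (coordinateSigma A) (Measure.infinitePi fun _ : ℕ => p) :=
  iIndepFun_infinitePi (P := fun _ : ℕ => p) (X := fun _ a => a) fun _ => measurable_id

lemma measurable_coordinate (S : Set ℕ) {i : ℕ} (hi : i ∈ S) :
    Measurable[⨆ i ∈ S, coordinateSigma A i] fun ω : ℕ → A => ω i :=
  Measurable.mono (comap_measurable _) (le_iSup₂_of_le i hi le_rfl) le_rfl

lemma measurable_iterate_shiftTwo (n : ℕ) :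
    Measurable[⨆ i ∈ Set.Ici (2 * n), coordinateSigma A i] (shiftTwo (A := A))^[n] := by
  refine (@measurable_pi_iff _ _ _ (⨆ i ∈ Set.Ici (2 * n), coordinateSigma A i) _ _).mpr
    fun k => ?_
  simp only [iterate_shiftTwo]
  exact measurable_coordinate _ (Set.mem_Ici.mpr (Nat.le_add_left _ _))

lemma measurePreserving_shiftTwo (p : Measure A) [IsProbabilityMeasure p] :
    MeasurePreserving shiftTwo (Measure.infinitePi fun _ : ℕ => p)
      (Measure.infinitePi fun _ : ℕ => p) :=
  ⟨measurable_pi_iff.mpr fun k => measurable_pi_apply (k + 2),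
    Measure.map_infinitePi_infinitePi_of_inj (P := fun _ : ℕ => p) (add_left_injective 2)⟩

/-- The square of the Bernoulli shift is ergodic. -/
theorem ergodic_shiftTwo (p : Measure A) [IsProbabilityMeasure p] :
    Ergodic shiftTwo (Measure.infinitePi fun _ : ℕ => p) := by
  refine ⟨measurePreserving_shiftTwo p, ⟨fun s hs hinv => ?_⟩⟩
  -- An invariant set equals its preimage under `shiftTwo^[n]`, so it depends only on coordinates
  -- from `2 * n` on. It is therefore a tail event, to which Kolmogorov's zero-one law applies.
  have hsn : ∀ n, MeasurableSet[⨆ i ∈ Set.Ici (2 * n), coordinateSigma A i] s := by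
    intro n
    have h1 : shiftTwo^[n] ⁻¹' s = s := by
      rw [Set.preimage_iterate_eq]
      exact Function.iterate_fixed hinv n
    rw [← h1]
    exact measurable_iterate_shiftTwo n hs
  have htail : MeasurableSet[limsup (coordinateSigma A) atTop] s := by
    rw [limsup_eq_iInf_iSup_of_nat]
    refine MeasurableSpace.measurableSet_iInf.mpr fun n => ?_
    refine (iSup₂_mono' fun i hi => ⟨i, ?_, le_rfl⟩ :
      (⨆ i ∈ Set.Ici (2 * n), coordinateSigma A i) ≤ ⨆ i ≥ n, coordinateSigma A i) s (hsn n)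
    have : 2 * n ≤ i := hi
    change n ≤ i
    omega
  rw [eventuallyConst_set']
  rcases measure_zero_or_one_of_measurableSet_limsup_atTop coordinateSigma_le
    (iIndep_coordinateSigma p) htail with h | h
  · exact Or.inl (ae_eq_empty.mpr h)
  · refine Or.inr (ae_eq_univ.mpr ?_)
    exact (prob_compl_eq_zero_iff hs).mpr h

lemma infinitePi_first_two [MeasurableSingletonClass A] (p : Measure A) [IsProbabilityMeasure p]
    (a : A × A) : (Measure.infinitePi fun _ : ℕ => p) ((fun ω => (ω 0, ω 1)) ⁻¹' {a}) =
      p {a.1} * p {a.2} := by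
  have h := Measure.infinitePi_map_eval_prod (P := fun _ : ℕ => p) zero_ne_one
  rw [← Measure.map_apply (by fun_prop) (measurableSet_singleton a), h,
    ← Measure.prod_prod, Set.singleton_prod_singleton]

lemma infinitePi_inter_shiftTwo [MeasurableSingletonClass A] (p : Measure A)
    [IsProbabilityMeasure p] (a : A × A) {B : Set (ℕ → A)} (hB : MeasurableSet B) :
    (Measure.infinitePi fun _ : ℕ => p) ((fun ω => (ω 0, ω 1)) ⁻¹' {a} ∩ shiftTwo ⁻¹' B) =
      (Measure.infinitePi fun _ : ℕ => p) ((fun ω => (ω 0, ω 1)) ⁻¹' {a}) *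
        (Measure.infinitePi fun _ : ℕ => p) B := by
  have hind := indep_iSup_of_disjoint coordinateSigma_le (iIndep_coordinateSigma p)
    (S := {i | i < 2}) (T := Set.Ici (2 * 1))
    (Set.disjoint_left.mpr fun i (hi : i < 2) (hi' : 2 ≤ i) => by omega)
  rw [← (measurePreserving_shiftTwo p).measure_preimage hB.nullMeasurableSet]
  have hT := measurable_iterate_shiftTwo (A := A) 1
  rw [Function.iterate_one] at hT
  rw [Indep_iff] at hind
  refine hind _ _ ?_ (hT hB)
  have h0 := measurable_coordinate (A := A) {i | i < 2} (i := 0) (by simp)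
  have h1 := measurable_coordinate (A := A) {i | i < 2} (i := 1) (by simp)
  exact (h0.prodMk h1) (measurableSet_singleton a)

end Bernoulli

/-- Additivity of entropy: `negMulLog (x * y)` is `y * negMulLog x + x * negMulLog y`, and each
double series factors. -/
lemma HasSum.negMulLog_mul {A : Type*} {f : A → ℝ} {H : ℝ}
    (h2 : HasSum (fun e => Real.negMulLog (f e)) H) (h1 : HasSum f 1) (hn1 : ∀ e, 0 ≤ f e)
    (hle : ∀ e, f e ≤ 1) :
    HasSum (fun a : A × A => Real.negMulLog (f a.1 * f a.2)) (2 * H) := by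
  have hn2 : ∀ e, 0 ≤ Real.negMulLog (f e) := fun e => Real.negMulLog_nonneg (hn1 e) (hle e)
  have h3 : HasSum (fun a : A × A => Real.negMulLog (f a.1) * f a.2) (H * 1) :=
    h2.mul h1 (h2.summable.mul_of_nonneg h1.summable hn2 hn1)
  have h4 : HasSum (fun a : A × A => f a.1 * Real.negMulLog (f a.2)) (1 * H) :=
    HasSum.mul (f := f) (g := fun e => Real.negMulLog (f e)) h1 h2
      (Summable.mul_of_nonneg (f := f) (g := fun e => Real.negMulLog (f e))
        h1.summable h2.summable hn1 hn2)
  have h5 := h3.add h4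
  rw [mul_one, one_mul, ← two_mul] at h5
  simpa only [Real.negMulLog_mul, mul_comm (f _) (Real.negMulLog _)] using h5

namespace RandomDiskIFS

instance {N : ℕ → ℕ} : DiscreteMeasurableSpace (Alphabet N) :=
  ⟨fun s => MeasurableSpace.measurableSet_iInf.mpr fun n =>
    (MeasurableSet.of_discrete : MeasurableSet ((fun i : Fin (N n) => (⟨n, i⟩ : Alphabet N)) ⁻¹' s))⟩

instance {N : ℕ → ℕ} (P : PMF (Alphabet N)) : IsProbabilityMeasure (bernoulliMeasure P) := by
  unfold bernoulliMeasure; infer_instance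

/-! ### Sums over the weights -/

section Weights

variable {N : ℕ → ℕ} (P : PMF (Alphabet N))

lemma toReal_weight_le_one (e : Alphabet N) : (P e).toReal ≤ 1 :=
  ENNReal.toReal_le_of_le_ofReal zero_le_one (by simpa using P.coe_le_one e)

lemma hasSum_weight : HasSum (fun e => (P e).toReal) 1 := by
  have h := ENNReal.hasSum_toReal (f := fun e => P e) (by rw [P.tsum_coe]; exact ENNReal.one_ne_top)
  rwa [← ENNReal.tsum_toReal_eq (fun e => P.apply_ne_top e), P.tsum_coe, ENNReal.toReal_one] at h

/-- The entropy of pairs of independent letters. -/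
lemma hasSum_negMulLog_pair (hP : Summable fun e => Real.negMulLog (P e).toReal) :
    HasSum (fun a : Alphabet N × Alphabet N =>
      Real.negMulLog ((P a.1).toReal * (P a.2).toReal)) (2 * weightEntropy P) := by
  rw [weightEntropy]
  exact hP.hasSum.negMulLog_mul (hasSum_weight P) (fun e => ENNReal.toReal_nonneg)
    (toReal_weight_le_one P)

/-- The sum `-∑ ν_e log r_n`. -/
noncomputable def meanLogRadius {ε : ℝ} (D : DiskFamily ε N) : ENNReal :=
  ∑' e : Alphabet N, P e * ENNReal.ofReal (-Real.log (D.r e.1))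

lemma lintegral_coordinate (f : Alphabet N → ENNReal) (i : ℕ) :
    ∫⁻ ω, f (ω i) ∂bernoulliMeasure P = ∑' e, P e * f e := by
  have h := lintegral_map (μ := bernoulliMeasure P) (f := f) (g := fun ω => ω i)
    (measurable_of_countable f) (measurable_pi_apply i)
  rw [← h, bernoulliMeasure, Measure.infinitePi_map_eval, lintegral_countable']
  refine tsum_congr fun e => ?_
  rw [P.toMeasure_apply_singleton e (measurableSet_singleton e), mul_comm]

end Weights

/-! ### Multiplicity of the overlaps -/

section Geometry

variable {ε : ℝ} {N : ℕ → ℕ} {D : DiskFamily ε N} (S : SimilaritySystem D)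

/-- Three disks through `x` would lie on one level, as different levels are disjoint, and would form
a triple point. This multiplicity is the origin of the term `log 2`. -/
lemma encard_le_two (D : DiskFamily ε N) (x : Plane) :
    {e : Alphabet N | x ∈ Metric.closedBall (D.c e) ((1 + ε) * D.r e.1)}.encard ≤ 2 := by
  by_contra! h
  obtain ⟨t, ht, ht3⟩ := Set.exists_subset_encard_eq (k := 3) (Order.add_one_le_of_lt h)
  obtain ⟨a, b, c, hab, hac, hbc, rfl⟩ := Set.encard_eq_three.mp ht3
  have ha := ht (by simp : a ∈ _)
  have hb := ht (by simp : b ∈ _)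
  have hc := ht (by simp : c ∈ _)
  simp only [Set.mem_ofPred_eq] at ha hb hc
  obtain ⟨n, i⟩ := a
  obtain ⟨k, j⟩ := b
  obtain ⟨l, u⟩ := c
  have hnk : n = k := by
    by_contra hne
    exact Set.disjoint_left.mp (D.disjoint_level n k hne i j) ha hb
  have hnl : n = l := by
    by_contra hne
    exact Set.disjoint_left.mp (D.disjoint_level n l hne i u) ha hc
  subst hnk hnl
  have := D.no_triple_point n i j u (fun h => hab (by rw [h])) (fun h => hac (by rw [h]))
    (fun h => hbc (by rw [h]))
  exact Set.notMem_empty x (this ▸ ⟨⟨ha, hb⟩, hc⟩)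

lemma encard_image_le_two (l : Param ε) (x : Plane) :
    {e | x ∈ S.toFun e l '' unitDisk}.encard ≤ 2 := by
  refine (Set.encard_le_encard fun e he => ?_).trans (encard_le_two D x)
  have h : x ∈ S.toFun e l '' unitDisk := he
  rw [S.image_eq] at h
  exact Metric.closedBall_subset_closedBall
    (mul_le_mul_of_nonneg_right l.2.2 (D.r_pos _).le) h

lemma param_pos (hε1 : ε < 1) (l : Param ε) : 0 < (l : ℝ) := by
  have := l.2.1
  linarith

lemma injOn_toFun (hε1 : ε < 1) (e : Alphabet N) (l : Param ε) :
    Set.InjOn (S.toFun e l) unitDisk := by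
  intro x hx y hy h
  have h1 := S.dist_eq e l x hx y hy
  rw [h, dist_self, eq_comm, mul_eq_zero] at h1
  exact dist_eq_zero.mp (h1.resolve_left (mul_pos (param_pos hε1 l) (D.r_pos _)).ne')

/-- At most four images of the unit disk under compositions of two maps have a common point. -/
lemma encard_pair_image_le_four (hε1 : ε < 1) (l l' : Param ε) (x : Plane) :
    {a : Alphabet N × Alphabet N |
      x ∈ S.toFun a.1 l '' (S.toFun a.2 l' '' unitDisk)}.encard ≤ 4 := by
  classical
  by_contra! h
  obtain ⟨t, ht, ht5⟩ := Set.exists_subset_encard_eq (k := 5) (Order.add_one_le_of_lt h)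
  obtain ⟨T, rfl⟩ : ∃ T : Finset (Alphabet N × Alphabet N), (T : Set _) = t :=
    (Set.finite_of_encard_eq_coe (k := 5) ht5).exists_finset_coe
  rw [Set.encard_coe_eq_coe_finsetCard] at ht5
  have hT : T.card = 5 := by exact_mod_cast ht5
  have himage : (T.image Prod.fst).card ≤ 2 := by
    have h1 : ((T.image Prod.fst : Finset _) : Set (Alphabet N)) ⊆
        {e | x ∈ S.toFun e l '' unitDisk} := by
      intro e he
      obtain ⟨a, ha, rfl⟩ := Finset.mem_image.mp (Finset.mem_coe.mp he)
      exact Set.image_mono (S.mapsTo a.2 l').image_subset (ht ha)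
    have h2 := (Set.encard_le_encard h1).trans (encard_image_le_two S l x)
    rw [Set.encard_coe_eq_coe_finsetCard] at h2
    exact_mod_cast h2
  -- For a fixed first letter, injectivity of its map gives `x` a single preimage `y` in the disk,
  -- and at most two second letters cover `y`.
  have hfib : ∀ e ∈ T.image Prod.fst, (T.filter fun a => a.1 = e).card ≤ 2 := by
    intro e he
    obtain ⟨a, ha, rfl⟩ := Finset.mem_image.mp he
    obtain ⟨y, hy, hyx⟩ := ht ha
    have hyd : y ∈ unitDisk := (S.mapsTo a.2 l').image_subset hy
    rw [← Finset.card_image_of_injOn (s := T.filter fun b => b.1 = a.1) (f := Prod.snd)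
      fun b hb c hc hbc => Prod.ext
        ((Finset.mem_filter.mp hb).2.trans (Finset.mem_filter.mp hc).2.symm) hbc]
    have h1 : (((T.filter fun b => b.1 = a.1).image Prod.snd : Finset _) : Set (Alphabet N)) ⊆
        {e | y ∈ S.toFun e l' '' unitDisk} := by
      intro e he
      obtain ⟨b, hb, rfl⟩ := Finset.mem_image.mp (Finset.mem_coe.mp he)
      obtain ⟨hbT, hba⟩ := Finset.mem_filter.mp hb
      obtain ⟨z, hz, hzx⟩ := ht hbT
      rw [hba, ← hyx] at hzx
      rwa [injOn_toFun S hε1 _ _ ((S.mapsTo b.2 l').image_subset hz) hyd hzx] at hz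
    have h2 := (Set.encard_le_encard h1).trans (encard_image_le_two S l' y)
    rw [Set.encard_coe_eq_coe_finsetCard] at h2
    exact_mod_cast h2
  have := Finset.card_le_mul_card_image T 2 hfib
  omega

lemma isCompact_pair_image (l l' : Param ε) (a : Alphabet N × Alphabet N) :
    IsCompact (S.toFun a.1 l '' (S.toFun a.2 l' '' unitDisk)) := by
  have hc : ∀ e k, ContinuousOn (S.toFun e k) unitDisk := fun e k => by
    have : LipschitzOnWith (Real.toNNReal ((k : ℝ) * D.r e.1)) (S.toFun e k) unitDisk :=
      LipschitzOnWith.of_dist_le' fun x hx y hy => (S.dist_eq e k x hx y hy).le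
    exact this.continuousOn
  rw [← Set.image_comp]
  exact (isCompact_closedBall _ _).image_of_continuousOn
    ((hc _ _).comp (hc _ _) (S.mapsTo _ _))

end Geometry

/-! ### Functional equation and measurability of the coding -/

section Coding

variable {ε : ℝ} {N : ℕ → ℕ} {D : DiskFamily ε N} (S : SimilaritySystem D) (hε : 0 < ε)
  (θ : Param ε → Param ε)

lemma coding_mem_image (l : Param ε) (ω : ℕ → Alphabet N) (n : ℕ) :
    S.coding hε θ l ω ∈ S.comp θ n l ω '' unitDisk := by
  have h : S.coding hε θ l ω ∈ ⋂ n : ℕ, S.comp θ n l ω '' unitDisk := by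
    rw [S.iInter_eq_coding hε θ l ω]
    exact Set.mem_singleton _
  exact Set.mem_iInter.mp h n

lemma coding_mem_unitDisk (l : Param ε) (ω : ℕ → Alphabet N) :
    S.coding hε θ l ω ∈ unitDisk := by
  simpa [SimilaritySystem.comp] using coding_mem_image S hε θ l ω 0

lemma coding_eq (l : Param ε) (ω : ℕ → Alphabet N) :
    S.coding hε θ l ω = S.toFun (ω 0) l (S.coding hε θ (θ l) fun k => ω (k + 1)) := by
  have h : S.toFun (ω 0) l (S.coding hε θ (θ l) fun k => ω (k + 1)) ∈
      ⋂ n : ℕ, S.comp θ n l ω '' unitDisk := by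
    refine Set.mem_iInter.mpr fun n => ?_
    cases n with
    | zero =>
      simpa [SimilaritySystem.comp] using S.mapsTo (ω 0) l (coding_mem_unitDisk S hε θ _ _)
    | succ n =>
      rw [SimilaritySystem.comp, Set.image_comp]
      exact Set.mem_image_of_mem _ (coding_mem_image S hε θ _ _ n)
  rw [S.iInter_eq_coding hε θ l ω] at h
  exact (Set.mem_singleton_iff.mp h).symm

/-- After two steps the parameter is back at `l`, so the same coding map appears on both sides: the
random system has become autonomous. -/
lemma coding_eq_of_involutive {l : Param ε} (hl : θ (θ l) = l) (ω : ℕ → Alphabet N) :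
    S.coding hε θ l ω =
      S.toFun (ω 0) l (S.toFun (ω 1) (θ l) (S.coding hε θ l (shiftTwo ω))) := by
  rw [coding_eq S hε θ l ω, coding_eq S hε θ (θ l), hl]
  rfl

lemma tendsto_comp_coding (l : Param ε) (ω : ℕ → Alphabet N) :
    Tendsto (fun n => S.comp θ n l ω 0) atTop (𝓝 (S.coding hε θ l ω)) := by
  obtain ⟨s, hs0, hs1, hs⟩ := D.exists_ratio hε
  have h0 : (0 : Plane) ∈ unitDisk := by simp
  refine tendsto_iff_dist_tendsto_zero.mpr (squeeze_zero (fun n => dist_nonneg) (fun n => ?_)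
    (tendsto_pow_atTop_nhds_zero_of_lt_one hs0 hs1))
  obtain ⟨u, hu, hux⟩ := coding_mem_image S hε θ l ω n
  rw [← hux]
  refine (S.comp_dist_le θ hs0 hs n l ω 0 h0 u hu).trans ?_
  refine mul_le_of_le_one_right (pow_nonneg hs0 n) ?_
  rw [dist_comm]
  exact hu

/-- For each letter the map is continuous in the point and measurable in the parameter, hence
jointly measurable; the letters are countable. Points are restricted to the disk because nothing is
known about `toFun` outside it. -/
lemma measurable_toFun_apply {β : Type*} [MeasurableSpace β] {e : β → Alphabet N}
    {l : β → Param ε} {x : β → Plane} (he : Measurable e) (hl : Measurable l) (hx : Measurable x)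
    (hxd : ∀ b, x b ∈ unitDisk) : Measurable fun b => S.toFun (e b) (l b) (x b) := by
  have h1 : ∀ a, Measurable (Function.uncurry fun (y : unitDisk) (l : Param ε) =>
      S.toFun a l y) := fun a => by
    refine measurable_uncurry_of_continuous_of_measurable (fun k => ?_)
      fun y => S.measurable_param a y y.2
    have : LipschitzWith (Real.toNNReal ((k : ℝ) * D.r a.1)) fun y : unitDisk => S.toFun a k y :=
      LipschitzWith.of_dist_le' fun y z => (S.dist_eq a k y y.2 z z.2).le
    exact this.continuous
  have h2 : Measurable fun p : Alphabet N × (unitDisk × Param ε) => S.toFun p.1 p.2.2 p.2.1 :=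
    measurable_from_prod_countable_right h1
  exact h2.comp (he.prodMk ((hx.subtype_mk (h := hxd)).prodMk hl))

lemma measurable_comp {θ : Param ε → Param ε} (hθ : Measurable θ) (n : ℕ) :
    Measurable fun p : Param ε × (ℕ → Alphabet N) => S.comp θ n p.1 p.2 0 := by
  induction n with
  | zero => exact measurable_const
  | succ n ih =>
    have hshift : Measurable fun p : Param ε × (ℕ → Alphabet N) =>
        (θ p.1, fun k => p.2 (k + 1)) :=
      (hθ.comp measurable_fst).prodMk (measurable_pi_iff.mpr fun k =>
        (measurable_pi_apply (k + 1)).comp measurable_snd)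
    exact measurable_toFun_apply S ((measurable_pi_apply 0).comp measurable_snd) measurable_fst
      (ih.comp hshift) fun p => S.comp_mapsTo θ n _ _ (by simp)

/-- The coding map is jointly measurable. -/
lemma measurable_coding {θ : Param ε → Param ε} (hθ : Measurable θ) :
    Measurable fun p : Param ε × (ℕ → Alphabet N) => S.coding hε θ p.1 p.2 :=
  measurable_of_tendsto_metrizable (measurable_comp S hθ)
    (tendsto_pi_nhds.mpr fun p => tendsto_comp_coding S hε θ p.1 p.2)

end Coding

end RandomDiskIFS

/-! ### Dyadic radii and the dimension at a fixed parameter -/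

namespace RandomDiskIFS

/-- The pointwise dimension is determined by the balls of radius `2⁻ᵏ`. -/
lemma hasPointwiseDimension_iff {X : Type*} [PseudoMetricSpace X] [MeasurableSpace X]
    {κ : Measure X} [IsProbabilityMeasure κ] {x : X} {d : ℝ} :
    HasPointwiseDimension κ x d ↔ (∀ k : ℕ, 0 < κ (Metric.ball x ((2⁻¹ : ℝ) ^ k))) ∧
      Tendsto (fun k : ℕ => Real.log (κ.real (Metric.ball x ((2⁻¹ : ℝ) ^ k))) /
        Real.log ((2⁻¹ : ℝ) ^ k)) atTop (𝓝 d) := by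
  have hR : ∀ k : ℕ, 0 < (2⁻¹ : ℝ) ^ k := fun k => by positivity
  have hR0 : Tendsto (fun k : ℕ => (2⁻¹ : ℝ) ^ k) atTop (𝓝 0) :=
    tendsto_pow_atTop_nhds_zero_of_lt_one (by norm_num) (by norm_num)
  constructor
  · rintro ⟨h1, h2⟩
    exact ⟨fun k => h1 _ (hR k), h2.comp (tendsto_nhdsWithin_iff.mpr
      ⟨hR0, Eventually.of_forall hR⟩)⟩
  · rintro ⟨h1, h2⟩
    refine ⟨fun r hr => ?_, ?_⟩
    · obtain ⟨k, hk⟩ := (hR0.eventually (gt_mem_nhds hr)).exists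
      exact (h1 k).trans_le (measure_mono (Metric.ball_subset_ball hk.le))
    have hlog : ∀ k : ℕ, Real.log ((2⁻¹ : ℝ) ^ k) = -(k * Real.log 2) := fun k => by
      rw [Real.log_pow, Real.log_inv]
      ring
    have hl2 : Real.log 2 ≠ 0 := (Real.log_pos one_lt_two).ne'
    -- For dyadic radii the rate of the masses is `d * log 2`, and `k / -log (2⁻¹ ^ k)` is `(log
    -- 2)⁻¹` for `k > 0`.
    have hd : d = d * Real.log 2 * (Real.log 2)⁻¹ := by field_simp
    rw [hd]
    refine tendsto_log_div_log_of_seq (V := fun r => κ.real (Metric.ball x r))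
      (U := fun k => κ.real (Metric.ball x ((2⁻¹ : ℝ) ^ k)))
      (fun k => ENNReal.toReal_pos (h1 k).ne' (measure_ne_top _ _)) (fun k => measureReal_le_one)
      hR hR0 ?_ ?_ ?_
    · intro n r hr1 hr2
      exact ⟨measureReal_mono (Metric.ball_subset_ball hr1.le),
        measureReal_mono (Metric.ball_subset_ball hr2)⟩
    · refine (h2.mul_const (Real.log 2)).congr fun k => ?_
      rw [hlog]
      rcases eq_or_ne (k : ℝ) 0 with hk | hk
      · simp [hk]
      · field_simp
    · refine tendsto_const_nhds.congr' ?_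
      filter_upwards [eventually_gt_atTop 0] with k hk
      have : (k : ℝ) ≠ 0 := by positivity
      rw [hlog]
      field_simp

/-- The exponent as a real number; by convention it is zero if it is infinite. -/
noncomputable def exponentReal {ε : ℝ} {N : ℕ → ℕ} (D : DiskFamily ε N) (P : PMF (Alphabet N))
    (a : ℝ) : ℝ :=
  if meanLogRadius P D = ⊤ then 0 else (meanLogRadius P D).toReal - a

section Fixed

variable {ε : ℝ} {N : ℕ → ℕ} {D : DiskFamily ε N} (S : SimilaritySystem D) (hε : 0 < ε)
  (θ : Param ε → Param ε) (P : PMF (Alphabet N))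

/-- If `θ (θ l) = l`, then the coding at the parameter `l` is autonomous with respect to pairs of
letters. -/
noncomputable def pairCoding (hε1 : ε < 1) (hθ : Measurable θ) {l : Param ε} (hl : θ (θ l) = l) :
    SelfSimilarCoding (bernoulliMeasure P) (Alphabet N × Alphabet N) Plane where
  shift := shiftTwo
  ergodic := ergodic_shiftTwo P.toMeasure
  letter := fun ω => (ω 0, ω 1)
  measurable_letter := (measurable_pi_apply 0).prodMk (measurable_pi_apply 1)
  indep := fun a _ hB => infinitePi_inter_shiftTwo P.toMeasure a hB
  coding := S.coding hε θ l
  measurable_coding := (measurable_coding S hε hθ).comp measurable_prodMk_left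
  dist_coding_le := fun ω ω' => by
    have h1 := dist_le_norm_add_norm (S.coding hε θ l ω) (S.coding hε θ l ω')
    have h2 := mem_closedBall_zero_iff.mp (coding_mem_unitDisk S hε θ l ω)
    have h3 := mem_closedBall_zero_iff.mp (coding_mem_unitDisk S hε θ l ω')
    linarith
  ratio := fun a => (l : ℝ) * D.r a.1.1 * ((θ l : ℝ) * D.r a.2.1)
  ratio_pos := fun a => mul_pos (mul_pos (param_pos hε1 l) (D.r_pos _))
    (mul_pos (param_pos hε1 (θ l)) (D.r_pos _))
  bound := (D.exists_ratio hε).choose * (D.exists_ratio hε).choose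
  bound_lt_one := by
    obtain ⟨h0, h1, -⟩ := (D.exists_ratio hε).choose_spec
    exact mul_lt_one_of_nonneg_of_lt_one_left h0 h1 h1.le
  ratio_le := fun a => by
    obtain ⟨h0, -, h2⟩ := (D.exists_ratio hε).choose_spec
    have h3 : ∀ (k : Param ε) (n : ℕ), (k : ℝ) * D.r n ≤ (D.exists_ratio hε).choose := fun k n =>
      (mul_le_mul_of_nonneg_right k.2.2 (D.r_pos _).le).trans (h2 n)
    exact mul_le_mul (h3 _ _) (h3 _ _)
      (mul_pos (param_pos hε1 (θ l)) (D.r_pos _)).le h0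
  dist_coding := fun ω ω' h => by
    have h0 : ω 0 = ω' 0 := congrArg Prod.fst h
    have h1 : ω 1 = ω' 1 := congrArg Prod.snd h
    rw [coding_eq_of_involutive S hε θ hl ω, coding_eq_of_involutive S hε θ hl ω', ← h0, ← h1,
      S.dist_eq _ _ _ (S.mapsTo _ _ (coding_mem_unitDisk S hε θ l _)) _
        (S.mapsTo _ _ (coding_mem_unitDisk S hε θ l _)),
      S.dist_eq _ _ _ (coding_mem_unitDisk S hε θ l _) _ (coding_mem_unitDisk S hε θ l _),
      ← mul_assoc]

lemma prob_pairCoding (hε1 : ε < 1) (hθ : Measurable θ) {l : Param ε} (hl : θ (θ l) = l)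
    (a : Alphabet N × Alphabet N) :
    (pairCoding S hε θ P hε1 hθ hl).prob a = (P a.1).toReal * (P a.2).toReal := by
  have h := infinitePi_first_two P.toMeasure a
  rw [P.toMeasure_apply_singleton _ (measurableSet_singleton _),
    P.toMeasure_apply_singleton _ (measurableSet_singleton _)] at h
  rw [← ENNReal.toReal_mul, ← h]
  rfl

/-- The constant `c` can have either sign, because parameters may exceed one. Its positive and
negative parts are put on opposite sides to avoid subtraction in `[0, ∞]`. -/
lemma lintegral_ratio_add (hε1 : ε < 1) (hθ : Measurable θ) {l : Param ε} (hl : θ (θ l) = l)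
    {c : ℝ} (hc : c = Real.log (l : ℝ) + Real.log (θ l : ℝ)) :
    ∫⁻ ω, ENNReal.ofReal (-Real.log ((pairCoding S hε θ P hε1 hθ hl).ratio
      ((pairCoding S hε θ P hε1 hθ hl).letter ω))) ∂bernoulliMeasure P + ENNReal.ofReal c =
      2 * meanLogRadius P D + ENNReal.ofReal (-c) := by
  let C := pairCoding S hε θ P hε1 hθ hl
  have hu0 : ∀ n, 0 ≤ -Real.log (D.r n) := fun n => by
    refine neg_nonneg.mpr (Real.log_nonpos (D.r_pos n).le ?_)
    obtain ⟨s, -, h1, h2⟩ := D.exists_ratio hε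
    have := h2 n
    have := mul_pos hε (D.r_pos n)
    linarith
  have hpt : ∀ ω : ℕ → Alphabet N, ENNReal.ofReal (-Real.log (C.ratio (C.letter ω))) +
      ENNReal.ofReal c = ENNReal.ofReal (-Real.log (D.r (ω 0).1)) +
        ENNReal.ofReal (-Real.log (D.r (ω 1).1)) + ENNReal.ofReal (-c) := by
    intro ω
    have h1 : Real.log (C.ratio (C.letter ω)) =
        Real.log (D.r (ω 0).1) + Real.log (D.r (ω 1).1) + c := by
      change Real.log ((l : ℝ) * D.r (ω 0).1 * ((θ l : ℝ) * D.r (ω 1).1)) = _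
      rw [Real.log_mul (mul_pos (param_pos hε1 l) (D.r_pos _)).ne'
        (mul_pos (param_pos hε1 (θ l)) (D.r_pos _)).ne',
        Real.log_mul (param_pos hε1 l).ne' (D.r_pos _).ne',
        Real.log_mul (param_pos hε1 (θ l)).ne' (D.r_pos _).ne', hc]
      ring
    have h2 : 0 ≤ -Real.log (C.ratio (C.letter ω)) :=
      neg_nonneg.mpr (Real.log_nonpos (C.ratio_pos _).le
        ((C.ratio_le _).trans C.bound_lt_one.le))
    rw [← ENNReal.ofReal_add (hu0 _) (hu0 _)]
    rcases le_total 0 c with h | h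
    · rw [← ENNReal.ofReal_add h2 h, ENNReal.ofReal_of_nonpos (p := -c) (by linarith), add_zero, h1]
      congr 1
      ring
    · rw [ENNReal.ofReal_of_nonpos h, add_zero,
        ← ENNReal.ofReal_add (add_nonneg (hu0 _) (hu0 _)) (neg_nonneg.mpr h), h1]
      congr 1
      ring
  have hm : ∀ i, Measurable fun ω : ℕ → Alphabet N =>
      ENNReal.ofReal (-Real.log (D.r (ω i).1)) := fun i =>
    (measurable_of_countable fun e : Alphabet N => ENNReal.ofReal (-Real.log (D.r e.1))).comp
      (measurable_pi_apply i)
  have hint : ∀ i, ∫⁻ ω, ENNReal.ofReal (-Real.log (D.r (ω i).1)) ∂bernoulliMeasure P =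
      meanLogRadius P D := fun i =>
    lintegral_coordinate P (fun e => ENNReal.ofReal (-Real.log (D.r e.1))) i
  calc ∫⁻ ω, ENNReal.ofReal (-Real.log (C.ratio (C.letter ω))) ∂bernoulliMeasure P +
        ENNReal.ofReal c
      = ∫⁻ ω, (ENNReal.ofReal (-Real.log (C.ratio (C.letter ω))) + ENNReal.ofReal c)
          ∂bernoulliMeasure P := by
        rw [lintegral_add_right _ measurable_const, lintegral_const, measure_univ, mul_one]
    _ = ∫⁻ ω, (ENNReal.ofReal (-Real.log (D.r (ω 0).1)) +
          ENNReal.ofReal (-Real.log (D.r (ω 1).1)) + ENNReal.ofReal (-c)) ∂bernoulliMeasure P :=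
        lintegral_congr hpt
    _ = 2 * meanLogRadius P D + ENNReal.ofReal (-c) := by
        rw [lintegral_add_right _ measurable_const, lintegral_add_right _ (hm 1), hint, hint,
          lintegral_const, measure_univ, mul_one, two_mul]

/-- The exponent of the pair system is twice the exponent sought. Positivity comes from the uniform
contraction of the pair maps. -/
lemma toReal_lintegral_ratio (hε1 : ε < 1) (hθ : Measurable θ) {l : Param ε}
    (hl : θ (θ l) = l) :
    (∫⁻ ω, ENNReal.ofReal (-Real.log ((pairCoding S hε θ P hε1 hθ hl).ratio
      ((pairCoding S hε θ P hε1 hθ hl).letter ω))) ∂bernoulliMeasure P).toReal =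
      2 * exponentReal D P ((Real.log (l : ℝ) + Real.log (θ l : ℝ)) / 2) ∧
    (meanLogRadius P D ≠ ⊤ →
      0 < exponentReal D P ((Real.log (l : ℝ) + Real.log (θ l : ℝ)) / 2)) := by
  have h := lintegral_ratio_add S hε θ P hε1 hθ hl rfl
  have hpos := (pairCoding S hε θ P hε1 hθ hl).lintegral_neg_log_ratio_pos
  set I := ∫⁻ ω, ENNReal.ofReal (-Real.log ((pairCoding S hε θ P hε1 hθ hl).ratio
      ((pairCoding S hε θ P hε1 hθ hl).letter ω))) ∂bernoulliMeasure P
  set c := Real.log (l : ℝ) + Real.log (θ l : ℝ)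
  unfold exponentReal
  rcases eq_or_ne (meanLogRadius P D) ⊤ with hX | hX
  · rw [hX, ENNReal.mul_top two_ne_zero, top_add, ENNReal.add_eq_top] at h
    rw [h.resolve_right ENNReal.ofReal_ne_top]
    simp [hX]
  · have hI : I ≠ ⊤ := by
      intro hI
      rw [hI, top_add] at h
      exact ENNReal.add_ne_top.mpr ⟨ENNReal.mul_ne_top ENNReal.ofNat_ne_top hX,
        ENNReal.ofReal_ne_top⟩ h.symm
    have h1 := congrArg ENNReal.toReal h
    rw [ENNReal.toReal_add hI ENNReal.ofReal_ne_top, ENNReal.toReal_add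
      (ENNReal.mul_ne_top ENNReal.ofNat_ne_top hX) ENNReal.ofReal_ne_top, ENNReal.toReal_mul,
      ENNReal.toReal_ofReal', ENNReal.toReal_ofReal', ENNReal.toReal_ofNat] at h1
    have h2 : max c 0 - max (-c) 0 = c := max_zero_sub_max_neg_zero_eq_self c
    have h3 : I.toReal = 2 * ((meanLogRadius P D).toReal - c / 2) := by linarith
    have h4 := ENNReal.toReal_pos hpos.ne' hI
    rw [if_neg hX]
    exact ⟨h3, fun _ => by linarith⟩

/-- The pointwise dimension at a fixed parameter. -/
theorem ae_exists_hasPointwiseDimension (hε1 : ε < 1) (hθ : Measurable θ) {l : Param ε}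
    (hl : θ (θ l) = l) (hP : Summable fun e => Real.negMulLog (P e).toReal) :
    ∀ᵐ ω ∂bernoulliMeasure P, ∃ d : ℝ,
      HasPointwiseDimension ((bernoulliMeasure P).map (S.coding hε θ l)) (S.coding hε θ l ω) d ∧
      (weightEntropy P - Real.log 2) /
        exponentReal D P ((Real.log (l : ℝ) + Real.log (θ l : ℝ)) / 2) ≤ d ∧
      d ≤ weightEntropy P /
        exponentReal D P ((Real.log (l : ℝ) + Real.log (θ l : ℝ)) / 2) := by
  let C := pairCoding S hε θ P hε1 hθ hl
  have hsum : HasSum (fun a => Real.negMulLog (C.prob a)) (2 * weightEntropy P) := by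
    simpa only [C, prob_pairCoding] using hasSum_negMulLog_pair P hP
  obtain ⟨h, hlo, hhi, hae⟩ := C.exists_hasPointwiseDimension hsum.summable
    (F := fun a => S.toFun a.1 l '' (S.toFun a.2 (θ l) '' unitDisk))
    (fun a => (isCompact_pair_image S l (θ l) a).isClosed.measurableSet)
    (fun ω => by
      change S.coding hε θ l ω ∈ _
      rw [coding_eq_of_involutive S hε θ hl ω]
      exact Set.mem_image_of_mem _ (Set.mem_image_of_mem _ (coding_mem_unitDisk S hε θ l _)))
    (K := 4) (by norm_num) (encard_pair_image_le_four S hε1 l (θ l))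
  rw [hsum.tsum_eq] at hlo hhi
  obtain ⟨hI, hpos⟩ := toReal_lintegral_ratio S hε θ P hε1 hθ hl
  -- Pair entropy, `log 4` and the pair exponent all carry a factor two, which cancels in the
  -- quotients.
  have h4 : Real.log ((4 : ℕ) : ℝ) = 2 * Real.log 2 := by
    rw [← Real.log_rpow two_pos]
    norm_num
  filter_upwards [hae] with ω hω
  refine ⟨_, hω, ?_⟩
  rw [hI]
  set χ := exponentReal D P ((Real.log (l : ℝ) + Real.log (θ l : ℝ)) / 2) with hχ
  rcases eq_or_ne (meanLogRadius P D) ⊤ with hX | hX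
  · have : χ = 0 := by rw [hχ, exponentReal, if_pos hX]
    simp [this]
  · have hχ0 := hpos hX
    rw [h4] at hlo
    constructor
    · rw [div_le_div_iff₀ hχ0 (by positivity)]
      nlinarith
    · rw [div_le_div_iff₀ (by positivity) hχ0]
      nlinarith

lemma exponent_eq (a : ℝ) : exponent D P a =
    if meanLogRadius P D = ⊤ then ⊤ else ((exponentReal D P a : ℝ) : EReal) := by
  change ((-a : ℝ) : EReal) + ((meanLogRadius P D : ENNReal) : EReal) = _
  unfold exponentReal
  split_ifs with h
  · rw [h, EReal.coe_ennreal_top, EReal.coe_add_top]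
  · lift meanLogRadius P D to NNReal using h with x
    rw [EReal.coe_nnreal_eq_coe_real, ← EReal.coe_add, ENNReal.coe_toReal, neg_add_eq_sub]

/-- Division by `⊤` in `EReal` and by `0` in `ℝ` both give `0`, so the convention in `exponentReal`
makes the two quotients agree. -/
lemma div_exponent_eq (x a : ℝ) :
    (x : EReal) / exponent D P a = ((x / exponentReal D P a : ℝ) : EReal) := by
  rw [exponent_eq]
  split_ifs with h
  · rw [exponentReal, if_pos h, div_zero, EReal.div_top, EReal.coe_zero]
  · rw [EReal.coe_div]

end Fixed

/-! ### Measurability in the parameter and passage to the product measure -/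

section Joint

variable {ε : ℝ} {N : ℕ → ℕ} {D : DiskFamily ε N} (S : SimilaritySystem D) (hε : 0 < ε)
  {θ : Param ε → Param ε} (P : PMF (Alphabet N))

lemma measurable_coding_right (hθ : Measurable θ) (l : Param ε) :
    Measurable (S.coding hε θ l) :=
  (measurable_coding S hε hθ).comp measurable_prodMk_left

lemma measurable_measure_ball_coding (hθ : Measurable θ) (r : ℝ) :
    Measurable fun p : Param ε × (ℕ → Alphabet N) =>
      (bernoulliMeasure P).map (S.coding hε θ p.1) (Metric.ball (S.coding hε θ p.1 p.2) r) := by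
  have hs : MeasurableSet {q : (Param ε × (ℕ → Alphabet N)) × (ℕ → Alphabet N) |
      dist (S.coding hε θ q.1.1 q.2) (S.coding hε θ q.1.1 q.1.2) < r} :=
    measurableSet_lt (((measurable_coding S hε hθ).comp
      ((measurable_fst.comp measurable_fst).prodMk measurable_snd)).dist
        ((measurable_coding S hε hθ).comp measurable_fst)) measurable_const
  convert measurable_measure_prodMk_left (ν := bernoulliMeasure P) hs using 2 with p
  exact Measure.map_apply (measurable_coding_right S hε hθ p.1) Metric.isOpen_ball.measurableSet

/-- Almost sure bounds for the pointwise dimension at almost every parameter hold almost surely for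
the product measure. -/
lemma ae_prod_exists_hasPointwiseDimension (hθ : Measurable θ) {m : Measure (Param ε)}
    [SFinite m] {lo hi : Param ε → ℝ} (hlo : Measurable lo) (hhi : Measurable hi)
    (h : ∀ᵐ l ∂m, ∀ᵐ ω ∂bernoulliMeasure P, ∃ d : ℝ,
      HasPointwiseDimension ((bernoulliMeasure P).map (S.coding hε θ l)) (S.coding hε θ l ω) d ∧
        lo l ≤ d ∧ d ≤ hi l) :
    ∀ᵐ p ∂m.prod (bernoulliMeasure P), ∃ d : ℝ,
      HasPointwiseDimension ((bernoulliMeasure P).map (S.coding hε θ p.1))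
        (S.coding hε θ p.1 p.2) d ∧ lo p.1 ≤ d ∧ d ≤ hi p.1 := by
  let W : ℕ → Param ε × (ℕ → Alphabet N) → ENNReal := fun k p =>
    (bernoulliMeasure P).map (S.coding hε θ p.1)
      (Metric.ball (S.coding hε θ p.1 p.2) ((2⁻¹ : ℝ) ^ k))
  let v : ℕ → Param ε × (ℕ → Alphabet N) → ℝ := fun k p =>
    Real.log (W k p).toReal / Real.log ((2⁻¹ : ℝ) ^ k)
  have hW : ∀ k, Measurable (W k) := fun k => measurable_measure_ball_coding S hε P hθ _
  have hv : ∀ k, Measurable (v k) := fun k =>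
    (Real.measurable_log.comp (hW k).ennreal_toReal).div_const _
  have hprob : ∀ l, IsProbabilityMeasure ((bernoulliMeasure P).map (S.coding hε θ l)) := fun l =>
    Measure.isProbabilityMeasure_map (measurable_coding_right S hε hθ l).aemeasurable
  -- Fubini in the needed direction requires a measurable event. Dyadic radii leave countably many
  -- functions, and the limsup replaces the quantified `d`.
  have hiff : ∀ p : Param ε × (ℕ → Alphabet N), (∃ d : ℝ,
      HasPointwiseDimension ((bernoulliMeasure P).map (S.coding hε θ p.1))
        (S.coding hε θ p.1 p.2) d ∧ lo p.1 ≤ d ∧ d ≤ hi p.1) ↔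
      ((∀ k, 0 < W k p) ∧ ∃ d, Tendsto (fun k => v k p) atTop (𝓝 d)) ∧
        lo p.1 ≤ limsup (fun k => v k p) atTop ∧ limsup (fun k => v k p) atTop ≤ hi p.1 := by
    intro p
    have := hprob p.1
    constructor
    · rintro ⟨d, hd, h1, h2⟩
      obtain ⟨h3, h4⟩ := hasPointwiseDimension_iff.mp hd
      have h5 : limsup (fun k => v k p) atTop = d := Tendsto.limsup_eq h4
      exact ⟨⟨h3, d, h4⟩, h5.symm ▸ h1, h5.symm ▸ h2⟩
    · rintro ⟨⟨h3, d, h4⟩, h1, h2⟩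
      rw [h4.limsup_eq] at h1 h2
      exact ⟨d, hasPointwiseDimension_iff.mpr ⟨h3, h4⟩, h1, h2⟩
  simp only [hiff]
  have hmeas : MeasurableSet {p : Param ε × (ℕ → Alphabet N) |
      ((∀ k, 0 < W k p) ∧ ∃ d, Tendsto (fun k => v k p) atTop (𝓝 d)) ∧
        lo p.1 ≤ limsup (fun k => v k p) atTop ∧
          limsup (fun k => v k p) atTop ≤ hi p.1} := by
    refine ((MeasurableSet.inter ?_ ?_).inter (MeasurableSet.inter ?_ ?_))
    · have hk : MeasurableSet (⋂ k, {p | 0 < W k p}) :=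
        MeasurableSet.iInter fun k => measurableSet_lt measurable_const (hW k)
      rwa [Set.iInter_ofPred] at hk
    · exact measurableSet_exists_tendsto hv
    · exact measurableSet_le (hlo.comp measurable_fst) (Measurable.limsup hv)
    · exact measurableSet_le (Measurable.limsup hv) (hhi.comp measurable_fst)
  refine (Measure.ae_prod_iff_ae_ae hmeas).mpr ?_
  filter_upwards [h] with l hl
  filter_upwards [hl] with ω hω
  exact (hiff (l, ω)).mp hω

end Joint

end RandomDiskIFS

/-! ### The dimension bounds for almost every pair -/

theorem mainTheorem5
    (ε : ℝ) (hε : 0 < ε) (hε1 : ε < 1) (N : ℕ → ℕ)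
    (D : RandomDiskIFS.DiskFamily ε N) (S : RandomDiskIFS.SimilaritySystem D)
    (θ : RandomDiskIFS.Param ε ≃ₜ RandomDiskIFS.Param ε)
    (m : Measure (RandomDiskIFS.Param ε)) [IsProbabilityMeasure m]
    (hm : m.map (Subtype.val : RandomDiskIFS.Param ε → ℝ) ≪ volume) (hθ : MeasurePreserving θ m m)
    (P : PMF (RandomDiskIFS.Alphabet N))
    (hP : Summable (fun e => Real.negMulLog (P e).toReal)) :
    (∀ᵐ p ∂(m.prod (RandomDiskIFS.bernoulliMeasure P)),
      let h : EReal := RandomDiskIFS.measureEntropy m θ + (RandomDiskIFS.weightEntropy P : EReal)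
      let χ : EReal := RandomDiskIFS.exponent D P
        ((Real.log (p.1 : ℝ) + Real.log (θ p.1 : ℝ)) / 2)
      0 < χ ∧ ∃ d : ℝ,
        RandomDiskIFS.HasPointwiseDimension
          ((RandomDiskIFS.bernoulliMeasure P).map (S.coding hε θ p.1))
          (S.coding hε θ p.1 p.2) d ∧
        (h - (Real.log 2 : EReal)) / χ ≤ (d : EReal) ∧ (d : EReal) ≤ h / χ) ∧
    (StrictMono θ →
      ∀ᵐ p ∂(m.prod (RandomDiskIFS.bernoulliMeasure P)),
        let h : EReal :=
          RandomDiskIFS.measureEntropy m θ + (RandomDiskIFS.weightEntropy P : EReal)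
        let χ : EReal := RandomDiskIFS.exponent D P (Real.log (p.1 : ℝ))
        0 < χ ∧ ∃ d : ℝ,
          RandomDiskIFS.HasPointwiseDimension
            ((RandomDiskIFS.bernoulliMeasure P).map (S.coding hε θ p.1))
            (S.coding hε θ p.1 p.2) d ∧
          (h - (Real.log 2 : EReal)) / χ ≤ (d : EReal) ∧ (d : EReal) ≤ h / χ) := by
  have hinv := RandomDiskIFS.ae_involutive_of_measurePreserving hε θ hθ
  have hθm : Measurable θ := θ.continuous.measurable
  have hfst : ∀ {q : RandomDiskIFS.Param ε → Prop}, (∀ᵐ l ∂m, q l) →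
      ∀ᵐ p ∂(m.prod (RandomDiskIFS.bernoulliMeasure P)), q p.1 := fun hq =>
    Measure.quasiMeasurePreserving_fst.ae hq
  have hχm : Measurable fun l : RandomDiskIFS.Param ε =>
      RandomDiskIFS.exponentReal D P ((Real.log (l : ℝ) + Real.log (θ l : ℝ)) / 2) := by
    unfold RandomDiskIFS.exponentReal
    split_ifs with h
    · exact measurable_const
    · exact (((Real.measurable_log.comp measurable_subtype_coe).add
        (Real.measurable_log.comp (measurable_subtype_coe.comp hθm))).div_const 2).const_sub _
  have hmain := RandomDiskIFS.ae_prod_exists_hasPointwiseDimension S hε P hθm (m := m)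
    (hχm.const_div (RandomDiskIFS.weightEntropy P - Real.log 2))
    (hχm.const_div (RandomDiskIFS.weightEntropy P)) (by
      filter_upwards [hinv] with l hl
      exact RandomDiskIFS.ae_exists_hasPointwiseDimension S hε θ P hε1 hθm hl hP)
  have hfirst : ∀ᵐ p ∂(m.prod (RandomDiskIFS.bernoulliMeasure P)),
      0 < RandomDiskIFS.exponent D P ((Real.log (p.1 : ℝ) + Real.log (θ p.1 : ℝ)) / 2) ∧
      ∃ d : ℝ, RandomDiskIFS.HasPointwiseDimension
          ((RandomDiskIFS.bernoulliMeasure P).map (S.coding hε θ p.1))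
          (S.coding hε θ p.1 p.2) d ∧
        (RandomDiskIFS.measureEntropy m θ + (RandomDiskIFS.weightEntropy P : EReal) -
          (Real.log 2 : EReal)) / RandomDiskIFS.exponent D P
            ((Real.log (p.1 : ℝ) + Real.log (θ p.1 : ℝ)) / 2) ≤ (d : EReal) ∧
        (d : EReal) ≤ (RandomDiskIFS.measureEntropy m θ +
          (RandomDiskIFS.weightEntropy P : EReal)) / RandomDiskIFS.exponent D P
            ((Real.log (p.1 : ℝ) + Real.log (θ p.1 : ℝ)) / 2) := by
    filter_upwards [hfst hinv, hmain] with p hp hdim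
    rw [RandomDiskIFS.measureEntropy_eq_zero m hinv, zero_add, ← EReal.coe_sub,
      RandomDiskIFS.div_exponent_eq, RandomDiskIFS.div_exponent_eq]
    simp only [EReal.coe_le_coe_iff]
    refine ⟨?_, hdim⟩
    rw [RandomDiskIFS.exponent_eq]
    split_ifs with hX
    · exact EReal.zero_lt_top
    · exact EReal.coe_pos.mpr
        ((RandomDiskIFS.toReal_lintegral_ratio S hε θ P hε1 hθm hp).2 hX)
  refine ⟨hfirst, fun hmono => ?_⟩
  -- For increasing `θ` the rigidity argument applies to `θ` itself, and the mean of the two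
  -- logarithms reduces to a single one.
  filter_upwards [hfst (hmono.ae_eq_id_of_measurePreserving hθ), hfirst] with p hp hdim
  rw [hp, add_self_div_two] at hdim
  exact hdim
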